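/- **Theorem (global isometry).** Let $\mathcal K$ be a field, $\Gamma\le\mathbb R$ an additive subgroup, and let $\Lambda=\{\sum_{g\in\Gamma}a_gT^g : a_g\in\mathcal K,\ \#\{g<c : a_g\ne 0\}<\infty \text{ for all } c\in\mathbb R\}$ be the Novikov field, with valuation $\nu(\sum a_gT^g)=\min\{g: a_g\neq 0\}$, $\nu(0)=\infty$. *Floer-type complexes.* A filtration function on a $\Lambda$-vector space $V$ is a map $\ell:V\to\mathbb R\cup\{-\infty\}$ with $\ell(x)=-\infty\iff x=0$, $\ell(\lambda x)=\ell(x)-\nu(\lambda)$ and $\ell(x+y)\le\max\{\ell(x),\ell(y)\}$. A finite family $(w_i)$ is orthogonal if $\ell(\sum\lambda_iw_i)=\max_i\ell(\lambda_iw_i)$ for all $\lambda_i\in\Lambda$; $(V,\ell)$ is orthogonalizable if $V$ is finite-dimensional and has an orthogonal basis. A Floer-type complex $(C_*,\partial,\ell)$ is a chain complex of $\Lambda$-vector spaces $(C_k)_{k\in\mathbb Z}$ with filtration functions $\ell$ on the $C_k$ such that every $(C_k,\ell)$ is orthogonalizable and $\ell(\partial x)\le\ell(x)$ for all $k$ and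 $x\in C_k$. *Barcodes.* Let $Z_k=\ker(\partial:C_k\to C_{k-1})$. A singular value decomposition of $\partial_{k+1}:C_{k+1}\to Z_k$, of rank $r$, consists of orthogonal ordered bases $(y_1,\dots,y_n)$ of $C_{k+1}$ and $(x_1,\dots,x_m)$ of $Z_k$ such that $(y_{r+1},\dots,y_n)$ is a basis of $\ker\partial_{k+1}$, $(x_1,\dots,x_r)$ is a basis of $\operatorname{Im}\partial_{k+1}$, $\partial y_i=x_i$ for $i\le r$, and $\ell(y_1)-\ell(x_1)\ge\dots\ge\ell(y_r)-\ell(x_r)$. The degree-$k$ concise barcode $\mathcal B_{C,k}$ is the multiset of elements of $(\mathbb R/\Gamma)\times(0,\infty]$ consisting of the pairs $([\ell(x_i)],\ell(y_i)-\ell(x_i))$ for those $i\le r$ with $\ell(y_i)>\ell(x_i)$, and the pairs $([\ell(x_i)],\infty)$ for $r<i\le m$. *Bottleneck distance.* For $\delta\ge0$, a $\delta$-matching between two multisets $\mathcal S,\mathcal T$ of elements of $(\mathbb R/\Gamma)\times[0,\infty]$ consists of submultisets $\mathcal S_{short}$, $\mathcal T_{short}$ all of whose elements $([a],L)$ satisfy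 $L\le2\delta$, and a bijection $\sigma:\mathcal S\setminus\mathcal S_{short}\to\mathcal T\setminus\mathcal T_{short}$ such that, if $\sigma([a],L)=([a'],L')$, then for every $\varepsilon>0$ the representative $a'$ of $[a']$ can be chosen with $|a'-a|\le\delta+\varepsilon$ and either $L=L'=\infty$ or ($L,L'<\infty$ and) $|(a'+L')-(a+L)|\le\delta+\varepsilon$. Then $d_B(\mathcal S,\mathcal T)\in[0,\infty]$ is the infimum of the $\delta\ge0$ for which a $\delta$-matching exists ($\inf\varnothing=\infty$), and $d_B(\mathcal B_C,\mathcal B_D)=\sup_{k\in\mathbb Z}d_B(\mathcal B_{C,k},\mathcal B_{D,k})$. *Interpolating distance.* Two Floer-type complexes $C,D$ are $\delta$-quasiequivalent ($\delta\ge 0$) if there are chain maps $\Phi:C_*\to D_*$, $\Psi:D_*\to C_*$ and degree-one $\Lambda$-linear maps $K_C$ of $C_*$ and $K_D$ of $D_*$ with $\Psi\Phi-I=\partial_CK_C+K_C\partial_C$, $\Phi\Psi-I=\partial_DK_D+K_D\partial_D$, and $\ell_D(\Phi c)\le\ell_C(c)+\delta$, $\ell_C(\Psi d)\le\ell_D(d)+\delta$,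 $\ell_C(K_Cc)\le\ell_C(c)+2\delta$, $\ell_D(K_Dd)\le\ell_D(d)+2\delta$ for all homogeneous $c,d$. A $\delta$-interpolation between $C$ and $D$ is a family of Floer-type complexes $C^s$, $s\in[0,1]\setminus S$ with $S\subset(0,1)$ finite, such that $C^0=C$, $C^1=D$, and $C^s$, $C^t$ are $\delta|s-t|$-quasiequivalent for all $s,t\in[0,1]\setminus S$. Let $d_P(C,D)\in[0,\infty]$ be the infimum of the $\delta\ge0$ for which a $\delta$-interpolation exists ($\inf\varnothing=\infty$). For any two Floer-type complexes $C$ and $D$ over $\Lambda$, singular value decompositions as above exist in every degree, and, whichever of them are used to compute the concise barcodes, in $[0,\infty]$ we have $$d_B(\mathcal B_C,\mathcal B_D)=d_P(C,D).$$ -/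

import Mathlib

open CategoryTheory
open scoped ENNReal NNReal

universe u v

namespace Floer

section NovikovField

/-- A Hahn series is left-finite if only finitely many exponents of its support lie below any
given real number. -/
def LeftFinite {K : Type u} [Field K] {Γ : AddSubgroup ℝ} (x : HahnSeries Γ K) : Prop :=
  ∀ c : ℝ, {g : Γ | x.coeff g ≠ 0 ∧ (g : ℝ) < c}.Finite

variable {K : Type u} [Field K] {Γ : AddSubgroup ℝ}

theorem LeftFinite.add {x y : HahnSeries Γ K} (hx : LeftFinite x) (hy : LeftFinite y) :
    LeftFinite (x + y) := by
  intro c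
  refine ((hx c).union (hy c)).subset ?_
  rintro g ⟨hg, hgc⟩
  by_cases h : x.coeff g = 0
  · right
    refine ⟨?_, hgc⟩
    rw [HahnSeries.coeff_add, h, zero_add] at hg
    exact hg
  · exact Or.inl ⟨h, hgc⟩

theorem LeftFinite.neg {x : HahnSeries Γ K} (hx : LeftFinite x) : LeftFinite (-x) := by
  intro c
  refine (hx c).subset ?_
  rintro g ⟨hg, hgc⟩
  refine ⟨?_, hgc⟩
  simpa using hg

theorem leftFinite_zero : LeftFinite (0 : HahnSeries Γ K) := by
  intro c
  simp

theorem leftFinite_single (a : Γ) (k : K) : LeftFinite (HahnSeries.single a k) := by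
  intro c
  refine (Set.finite_singleton a).subset ?_
  rintro g ⟨hg, -⟩
  by_contra h
  exact hg (HahnSeries.coeff_single_of_ne h)

theorem leftFinite_one : LeftFinite (1 : HahnSeries Γ K) :=
  leftFinite_single 0 1

theorem LeftFinite.mul {x y : HahnSeries Γ K} (hx : LeftFinite x) (hy : LeftFinite y) :
    LeftFinite (x * y) := by
  by_cases hx0 : x = 0
  · simpa [hx0] using leftFinite_zero
  by_cases hy0 : y = 0
  · simpa [hy0] using leftFinite_zero
  intro c
  have h := (hx (c - (y.order : ℝ))).image2 (fun a b : Γ => a + b) (hy (c - (x.order : ℝ)))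
  refine h.subset ?_
  rintro g ⟨hg, hgc⟩
  obtain ⟨a, ha, b, hb, rfl⟩ := Set.mem_add.1 (HahnSeries.support_mul_subset hg)
  have h1 : x.order ≤ a := HahnSeries.order_le_of_coeff_ne_zero ha
  have h2 : y.order ≤ b := HahnSeries.order_le_of_coeff_ne_zero hb
  have h1' : (x.order : ℝ) ≤ a := h1
  have h2' : (y.order : ℝ) ≤ b := h2
  have hgc' : (a : ℝ) + b < c := by simpa using hgc
  exact ⟨a, ⟨ha, by linarith⟩, b, ⟨hb, by linarith⟩, rfl⟩

theorem LeftFinite.pow {x : HahnSeries Γ K} (hx : LeftFinite x) (n : ℕ) :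
    LeftFinite (x ^ n) := by
  induction n with
  | zero => simpa using leftFinite_one
  | succ n ih => rw [pow_succ]; exact ih.mul hx

theorem LeftFinite.sum_pow {x : HahnSeries Γ K} (hx : LeftFinite x) (n : ℕ) :
    LeftFinite (∑ i ∈ Finset.range n, x ^ i) := by
  induction n with
  | zero => simpa using leftFinite_zero
  | succ n ih => rw [Finset.sum_range_succ]; exact ih.add (hx.pow n)

theorem LeftFinite.inv_one_sub {x : HahnSeries Γ K} (hx : LeftFinite x)
    (hpos : 0 < x.orderTop) : LeftFinite (1 - x)⁻¹ := by
  by_cases hx0 : x = 0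
  · simpa [hx0] using leftFinite_one
  have hne : (1 - x) ≠ 0 := by
    intro h
    rw [sub_eq_zero] at h
    rw [← h] at hpos
    simp at hpos
  have hvne : (1 - x)⁻¹ ≠ 0 := inv_ne_zero hne
  have hord : (0 : ℝ) < (x.order : ℝ) := by
    have : (0 : Γ) < x.order := by
      rw [← HahnSeries.order_eq_orderTop_of_ne_zero hx0] at hpos
      exact_mod_cast hpos
    exact this
  intro c
  obtain ⟨n, hn⟩ := exists_nat_gt ((c - ((1 - x)⁻¹.order : ℝ)) / x.order)
  have hn' : c < n * (x.order : ℝ) + ((1 - x)⁻¹.order : ℝ) := by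
    rw [div_lt_iff₀ hord] at hn
    linarith
  have key : (1 - x)⁻¹ = (∑ i ∈ Finset.range n, x ^ i) + x ^ n * (1 - x)⁻¹ := by
    have := mul_neg_geom_sum x n
    field_simp
    linear_combination (-1 : HahnSeries Γ K) * this
  refine (hx.sum_pow n c).subset ?_
  rintro g ⟨hg, hgc⟩
  refine ⟨?_, hgc⟩
  have hz : (x ^ n * (1 - x)⁻¹).coeff g = 0 := by
    by_contra h
    have h1 : (x ^ n * (1 - x)⁻¹).order ≤ g := HahnSeries.order_le_of_coeff_ne_zero h
    rw [HahnSeries.order_mul (pow_ne_zero n hx0) hvne, HahnSeries.order_pow] at h1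
    have h2 : (n : ℝ) * (x.order : ℝ) + ((1 - x)⁻¹.order : ℝ) ≤ g := by
      have h3 : ((n • x.order + (1 - x)⁻¹.order : Γ) : ℝ) ≤ g := h1
      simpa using h3
    linarith
  rw [key, HahnSeries.coeff_add, hz, add_zero] at hg
  exact hg

theorem LeftFinite.inv {x : HahnSeries Γ K} (hx : LeftFinite x) : LeftFinite x⁻¹ := by
  by_cases hx0 : x = 0
  · simpa [hx0] using leftFinite_zero
  have hl : x.leadingCoeff ≠ 0 := HahnSeries.leadingCoeff_ne_zero.2 hx0
  set s : HahnSeries Γ K := HahnSeries.single (-x.order) x.leadingCoeff⁻¹ with hs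
  have hs0 : s ≠ 0 := by simpa [hs] using hl
  have hsf : LeftFinite s := leftFinite_single _ _
  have hu : LeftFinite (1 - s * x) := by
    rw [sub_eq_add_neg]
    exact leftFinite_one.add (hsf.mul hx).neg
  have hpos : 0 < (1 - s * x).orderTop :=
    HahnSeries.unit_aux x (inv_mul_cancel₀ hl) (-x.order) (neg_add_cancel _)
  have := hu.inv_one_sub hpos
  have he : x⁻¹ = s * (1 - (1 - s * x))⁻¹ := by
    rw [sub_sub_cancel, mul_inv, ← mul_assoc, mul_inv_cancel₀ hs0, one_mul]
  rw [he]
  exact hsf.mul this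

variable (K Γ)

/-- The Novikov field `Λ^{K,Γ}`: formal sums `∑ a_g T^g` with `g ∈ Γ` and `a_g ∈ K` such that for
every real `c` only finitely many `g < c` have `a_g ≠ 0`, as a subfield of the Hahn series. -/
noncomputable def novikovField : Subfield (HahnSeries Γ K) where
  carrier := {x | LeftFinite x}
  mul_mem' := LeftFinite.mul
  one_mem' := leftFinite_one
  add_mem' := LeftFinite.add
  zero_mem' := leftFinite_zero
  neg_mem' := LeftFinite.neg
  inv_mem' _ := LeftFinite.inv

/-- The Novikov field as a type. -/
noncomputable abbrev Novikov : Type u := novikovField K Γ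

end NovikovField

variable {K : Type u} [Field K] {Γ : AddSubgroup ℝ}

/-- The valuation `ν(∑ a_g T^g) = min {g | a_g ≠ 0}`, with `ν(0) = ∞`. -/
noncomputable def valuation (x : Novikov K Γ) : EReal :=
  open scoped Classical in
  if (x : HahnSeries Γ K) = 0 then ⊤
  else (((x : HahnSeries Γ K).order : ℝ) : EReal)

section NormedSpaces

variable {V : Type v} [AddCommGroup V] [Module (Novikov K Γ) V]
variable {W : Type v} [AddCommGroup W] [Module (Novikov K Γ) W]

/-- `ℓ : V → ℝ ∪ {-∞}` is a filtration function making `V` a non-Archimedean normed vector space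
over the Novikov field. -/
structure IsFiltration (ℓ : V → EReal) : Prop where
  ne_top : ∀ x, ℓ x ≠ ⊤
  eq_bot_iff : ∀ x, ℓ x = ⊥ ↔ x = 0
  smul : ∀ (c : Novikov K Γ) (x : V), ℓ (c • x) = ℓ x - valuation c
  add_le : ∀ x y, ℓ (x + y) ≤ max (ℓ x) (ℓ y)

/-- A finite family `w` is orthogonal if `ℓ(∑ λ_i w_i) = max_i ℓ(λ_i w_i)` for all scalars `λ_i`
(the maximum of the empty family being `-∞`). -/
def IsOrthogonal {ι : Type*} [Fintype ι] (ℓ : V → EReal) (w : ι → V) : Prop :=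
  ∀ c : ι → Novikov K Γ, ℓ (∑ i, c i • w i) = Finset.univ.sup fun i => ℓ (c i • w i)

/-- `(V, ℓ)` is orthogonalizable: a finite-dimensional non-Archimedean normed vector space with an
orthogonal basis. -/
structure IsOrthogonalizable (ℓ : V → EReal) : Prop where
  isFiltration : IsFiltration (K := K) (Γ := Γ) ℓ
  exists_basis : ∃ (n : ℕ) (b : Module.Basis (Fin n) (Novikov K Γ) V),
    IsOrthogonal (K := K) (Γ := Γ) ℓ b

/-- A singular value decomposition of a linear map `A : V → W` between orthogonalizable spaces:
orthogonal ordered bases `(y_1, …, y_r, y_{r+1}, …, y_{r+p})` of `V` and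
`(x_1, …, x_r, x_{r+1}, …, x_{r+q})` of `W`, such that the last `p` of the `y`'s form a basis of
`ker A`, the first `r` of the `x`'s form a basis of the image of `A`, `A y_i = x_i` for `i ≤ r`, and
`ℓ(y_1) - ℓ(x_1) ≥ … ≥ ℓ(y_r) - ℓ(x_r)`. A part of an orthogonal basis is automatically orthogonal
and linearly independent, so that it is enough to prescribe the spans; in particular `r` is the
rank of `A`. -/
structure SVD (ℓV : V → EReal) (ℓW : W → EReal) (A : V →ₗ[Novikov K Γ] W) where
  r : ℕ
  p : ℕ
  q : ℕ
  y : Module.Basis (Fin r ⊕ Fin p) (Novikov K Γ) V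
  x : Module.Basis (Fin r ⊕ Fin q) (Novikov K Γ) W
  orthogonal_y : IsOrthogonal (K := K) (Γ := Γ) ℓV y
  orthogonal_x : IsOrthogonal (K := K) (Γ := Γ) ℓW x
  span_ker : Submodule.span (Novikov K Γ) (Set.range fun j => y (Sum.inr j)) = LinearMap.ker A
  span_range : Submodule.span (Novikov K Γ) (Set.range fun i => x (Sum.inl i)) = LinearMap.range A
  map_y : ∀ i, A (y (Sum.inl i)) = x (Sum.inl i)
  sorted : Antitone fun i : Fin r => ℓV (y (Sum.inl i)) - ℓW (x (Sum.inl i))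

end NormedSpaces

variable (K Γ) in
/-- A Floer-type complex over the Novikov field: a `ℤ`-graded chain complex with a filtration
function on each graded piece which makes it orthogonalizable, such that the boundary operator
does not increase the filtration. -/
structure FloerComplex where
  cx : ChainComplex (ModuleCat.{v} (Novikov K Γ)) ℤ
  ℓ : ∀ k : ℤ, cx.X k → EReal
  orthogonalizable : ∀ k, IsOrthogonalizable (K := K) (Γ := Γ) (ℓ k)
  d_le : ∀ (k : ℤ) (x : cx.X (k + 1)), ℓ k ((cx.d (k + 1) k).hom x) ≤ ℓ (k + 1) x

namespace FloerComplex

/-- The cycles `Z_k`, the kernel of `∂_k : C_k → C_{k-1}`. -/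
noncomputable def cycles (C : FloerComplex.{u, v} K Γ) (k : ℤ) : Submodule (Novikov K Γ) (C.cx.X k) :=
  LinearMap.ker (C.cx.d k (k - 1)).hom

/-- The boundary operator `∂_{k+1}`, regarded as a linear map `C_{k+1} → Z_k`. -/
noncomputable def boundary (C : FloerComplex.{u, v} K Γ) (k : ℤ) :
    C.cx.X (k + 1) →ₗ[Novikov K Γ] C.cycles k :=
  LinearMap.codRestrict (C.cycles k) (C.cx.d (k + 1) k).hom fun x => by
    have h := C.cx.d_comp_d (k + 1) k (k - 1)
    exact congrArg (fun f => f.hom x) h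

/-- Singular value decompositions of `∂_{k+1} : C_{k+1} → Z_k`. -/
abbrev BoundarySVD (C : FloerComplex.{u, v} K Γ) (k : ℤ) : Type (max u v) :=
  SVD (C.ℓ (k + 1)) (fun z : C.cycles k => C.ℓ k z) (C.boundary k)

end FloerComplex

variable (Γ) in
/-- Pairs `([a], L)` in `(ℝ/Γ) × [0, ∞]`. -/
abbrev Bar : Type := (ℝ ⧸ Γ) × ℝ≥0∞

/-- The degree-`k` verbose barcode, read off from a singular value decomposition: the pairs
`([ℓ(x_i)], ℓ(y_i) - ℓ(x_i))` for `i ≤ r` and `([ℓ(x_i)], ∞)` for `i > r`. -/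
noncomputable def verboseBarcode {C : FloerComplex.{u, v} K Γ} {k : ℤ} (s : C.BoundarySVD k) :
    Multiset (Bar Γ) :=
  (Finset.univ : Finset (Fin s.r)).val.map
      (fun i => (((C.ℓ k (s.x (Sum.inl i))).toReal : ℝ ⧸ Γ),
        (C.ℓ (k + 1) (s.y (Sum.inl i)) - C.ℓ k (s.x (Sum.inl i))).toENNReal)) +
    (Finset.univ : Finset (Fin s.q)).val.map
      (fun j => (((C.ℓ k (s.x (Sum.inr j))).toReal : ℝ ⧸ Γ), (⊤ : ℝ≥0∞)))

/-- The degree-`k` concise barcode: the elements of the verbose barcode with positive second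
coordinate. -/
noncomputable def conciseBarcode {C : FloerComplex.{u, v} K Γ} {k : ℤ} (s : C.BoundarySVD k) :
    Multiset (Bar Γ) :=
  open scoped Classical in (verboseBarcode s).filter fun b => 0 < b.2

/-- The condition on a matched pair `σ([a], L) = ([a'], L')` in a `δ`-matching: for all `ε > 0` the
representative `a'` can be chosen with `|a' - a| ≤ δ + ε` and either `L = L' = ∞` or
`|(a' + L') - (a + L)| ≤ δ + ε`. -/
def BarClose (δ : ℝ≥0) (b b' : Bar Γ) : Prop :=
  ∀ a : ℝ, (a : ℝ ⧸ Γ) = b.1 → ∀ ε : ℝ, 0 < ε → ∃ a' : ℝ, (a' : ℝ ⧸ Γ) = b'.1 ∧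
    |a' - a| ≤ δ + ε ∧
    ((b.2 = ⊤ ∧ b'.2 = ⊤) ∨
      (b.2 ≠ ⊤ ∧ b'.2 ≠ ⊤ ∧ |(a' + b'.2.toReal) - (a + b.2.toReal)| ≤ δ + ε))

/-- There is a `δ`-matching between the multisets `S` and `T`: after removing submultisets of
elements with `L ≤ 2δ` there is a bijection between the remaining ones which matches close bars. -/
def HasMatching (δ : ℝ≥0) (S T : Multiset (Bar Γ)) : Prop :=
  ∃ Sshort Slong Tshort Tlong : Multiset (Bar Γ),
    S = Sshort + Slong ∧ T = Tshort + Tlong ∧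
    (∀ b ∈ Sshort, b.2 ≤ 2 * (δ : ℝ≥0∞)) ∧ (∀ b ∈ Tshort, b.2 ≤ 2 * (δ : ℝ≥0∞)) ∧
    Multiset.Rel (BarClose δ) Slong Tlong

/-- The bottleneck distance between two multisets of bars. -/
noncomputable def bottleneckDist (S T : Multiset (Bar Γ)) : ℝ≥0∞ :=
  ⨅ (δ : ℝ≥0) (_ : HasMatching δ S T), (δ : ℝ≥0∞)

/-- The bottleneck distance between two `ℤ`-indexed families of multisets of bars. -/
noncomputable def gradedBottleneckDist (S T : ℤ → Multiset (Bar Γ)) : ℝ≥0∞ :=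
  ⨆ k : ℤ, bottleneckDist (S k) (T k)

/-- `C` and `D` are `δ`-quasiequivalent (for `δ ≥ 0`): there are chain maps `Φ : C → D`,
`Ψ : D → C` raising the filtration by at most `δ`, and chain homotopies from `Ψ ∘ Φ` and `Φ ∘ Ψ`
to the identities raising the filtration by at most `2δ`. -/
def Quasiequivalent (δ : ℝ) (C D : FloerComplex.{u, v} K Γ) : Prop :=
  ∃ (Φ : C.cx ⟶ D.cx) (Ψ : D.cx ⟶ C.cx)
    (hC : Homotopy (Φ ≫ Ψ) (𝟙 C.cx)) (hD : Homotopy (Ψ ≫ Φ) (𝟙 D.cx)),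
    (∀ (k : ℤ) (c : C.cx.X k), D.ℓ k ((Φ.f k).hom c) ≤ C.ℓ k c + (δ : EReal)) ∧
    (∀ (k : ℤ) (d : D.cx.X k), C.ℓ k ((Ψ.f k).hom d) ≤ D.ℓ k d + (δ : EReal)) ∧
    (∀ (k : ℤ) (c : C.cx.X k),
      C.ℓ (k + 1) ((hC.hom k (k + 1)).hom c) ≤ C.ℓ k c + ((2 * δ : ℝ) : EReal)) ∧
    (∀ (k : ℤ) (d : D.cx.X k),
      D.ℓ (k + 1) ((hD.hom k (k + 1)).hom d) ≤ D.ℓ k d + ((2 * δ : ℝ) : EReal))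

/-- There is a `δ`-interpolation between `C` and `D`: a family of Floer-type complexes `F s`, for
`s` in `[0,1]` outside a finite set `S ⊆ (0,1)`, from `C` to `D`, whose members at `s` and `t` are
`δ|s - t|`-quasiequivalent. (The values of `F` elsewhere are irrelevant.) -/
def HasInterpolation (δ : ℝ≥0) (C D : FloerComplex.{u, v} K Γ) : Prop :=
  ∃ (S : Finset ℝ) (F : ℝ → FloerComplex.{u, v} K Γ),
    (S : Set ℝ) ⊆ Set.Ioo 0 1 ∧ F 0 = C ∧ F 1 = D ∧
    ∀ s ∈ Set.Icc (0 : ℝ) 1 \ S, ∀ t ∈ Set.Icc (0 : ℝ) 1 \ S,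
      Quasiequivalent (δ * |s - t|) (F s) (F t)

/-- The interpolating distance `d_P`. -/
noncomputable def interpolatingDist (C D : FloerComplex.{u, v} K Γ) : ℝ≥0∞ :=
  ⨅ (δ : ℝ≥0) (_ : HasInterpolation δ C D), (δ : ℝ≥0∞)

end Floer

/-! A singular value decomposition splits a complex into bars: the level of `x_i` is the left end of
a bar, and the level of `y_i`, when there is one, is its right end. Decompositions exist by Gaussian
elimination over the Novikov field with a greedy choice of pivots (`exists_singular_families`).

For `d_B ≤ d_P` only the two ends of an interpolation matter: they are themselves
`δ`-quasiequivalent, and this already gives a `δ`-matching with the same constant. The coefficients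
of `Φ` and `Ψ` on boundaries satisfy a valuation bound at the left ends and another at the right
ends of the bars. When two bars are not `δ`-close modulo `Γ`, these two bounds force the valuation
strictly above the difference of the midpoints (`lt_valuation_of_not_close`). For bars longer than
`2δ`, the homotopy bound does the same for the entries of `ΨΦ - I`. If Hall's condition failed, some
nonzero vector would be killed by all rows of `Φ` that belong to close bars, and its leading entry,
relative to the midpoints, would have valuation larger than itself (`exists_injective_close`). So
the long bars of each side inject into close bars of the other, and `exists_matching_covering`
merges the two injections into one matching. Infinite bars are treated in the same way, as
degenerate intervals.

For `d_P ≤ d_B`, take a `δ`-matching in every degree and `ρ > δ`. After rescaling the bases by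
monomials, matched bars have endpoints within `ρ` of each other. Moving endpoints linearly, and
shrinking each unmatched short bar to its midpoint, gives a family of complexes with explicit bases.
Bars missing from an end of the family have length zero there, so contracting them elsewhere costs
at most twice the distance moved (`BarModel.quasiequivalent`). The slack `ρ - δ` disappears in the
infimum. -/

namespace Floer

/-! ### The valuation on the Novikov field -/

section Valuation

variable {K : Type u} [Field K] {Γ : AddSubgroup ℝ}

@[simp] theorem valuation_zero : valuation (0 : Novikov K Γ) = ⊤ := by simp [valuation]

theorem valuation_of_ne_zero {x : Novikov K Γ} (hx : x ≠ 0) :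
    valuation x = (((x : HahnSeries Γ K).order : ℝ) : EReal) := by
  have : (x : HahnSeries Γ K) ≠ 0 := by simpa using hx
  simp [valuation, this]

theorem valuation_ne_bot (x : Novikov K Γ) : valuation x ≠ ⊥ := by
  by_cases hx : x = 0
  · simp [hx]
  · rw [valuation_of_ne_zero hx]; exact EReal.coe_ne_bot _

theorem valuation_mul (x y : Novikov K Γ) : valuation (x * y) = valuation x + valuation y := by
  by_cases hx : x = 0
  · simp [hx, EReal.top_add_of_ne_bot (valuation_ne_bot y)]
  by_cases hy : y = 0
  · simp [hy, EReal.add_top_of_ne_bot (valuation_ne_bot x)]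
  rw [valuation_of_ne_zero hx, valuation_of_ne_zero hy, valuation_of_ne_zero (mul_ne_zero hx hy)]
  have hx' : (x : HahnSeries Γ K) ≠ 0 := by simpa using hx
  have hy' : (y : HahnSeries Γ K) ≠ 0 := by simpa using hy
  have := HahnSeries.order_mul hx' hy'
  rw [Subfield.coe_mul, this]
  push_cast
  rfl

@[simp] theorem valuation_one : valuation (1 : Novikov K Γ) = 0 := by
  rw [valuation_of_ne_zero one_ne_zero]
  simp

theorem min_valuation_le_add (x y : Novikov K Γ) :
    min (valuation x) (valuation y) ≤ valuation (x + y) := by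
  by_cases hx : x = 0
  · simp [hx]
  by_cases hy : y = 0
  · simp [hy]
  by_cases hxy : x + y = 0
  · simp [hxy]
  rw [valuation_of_ne_zero hx, valuation_of_ne_zero hy, valuation_of_ne_zero hxy]
  have hxy' : (x : HahnSeries Γ K) + y ≠ 0 := by exact_mod_cast hxy
  have := HahnSeries.min_order_le_order_add hxy'
  rw [min_le_iff] at this ⊢
  exact this.imp (fun h => EReal.coe_le_coe_iff.2 h) fun h => EReal.coe_le_coe_iff.2 h

theorem lt_valuation_sum {ι : Type*} (s : Finset ι) (f : ι → Novikov K Γ) (r : ℝ)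
    (h : ∀ i ∈ s, (r : EReal) < valuation (f i)) : (r : EReal) < valuation (∑ i ∈ s, f i) := by
  classical
  induction s using Finset.induction_on with
  | empty => simp [EReal.coe_lt_top]
  | insert a s ha ih =>
    rw [Finset.sum_insert ha]
    refine lt_of_lt_of_le (lt_min (h a (by simp)) (ih fun i hi => h i (by simp [hi]))) ?_
    exact min_valuation_le_add _ _

/-- The monomial `T^g`. -/
noncomputable def monomial (K : Type u) [Field K] {Γ : AddSubgroup ℝ} (g : Γ) : Novikov K Γ :=
  ⟨HahnSeries.single g 1, leftFinite_single g 1⟩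

theorem monomial_ne_zero (g : Γ) : monomial K g ≠ 0 := by
  intro h
  have := congrArg Subtype.val h
  simp [monomial] at this

theorem valuation_monomial (g : Γ) : valuation (monomial K g) = ((g : ℝ) : EReal) := by
  rw [valuation_of_ne_zero (monomial_ne_zero g)]
  simp [monomial]

end Valuation

/-! ### Filtration functions and orthogonal families -/

section Filtration

variable {K : Type u} [Field K] {Γ : AddSubgroup ℝ}
variable {V : Type v} [AddCommGroup V] [Module (Novikov K Γ) V] {ℓ : V → EReal}

namespace IsFiltration

theorem zero (hF : IsFiltration (K := K) (Γ := Γ) ℓ) : ℓ 0 = ⊥ := (hF.eq_bot_iff 0).2 rfl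

theorem coe_toReal (hF : IsFiltration (K := K) (Γ := Γ) ℓ) {x : V} (hx : x ≠ 0) :
    ((ℓ x).toReal : EReal) = ℓ x :=
  EReal.coe_toReal (hF.ne_top x) fun h => hx ((hF.eq_bot_iff x).1 h)

theorem smul_of_ne_zero (hF : IsFiltration (K := K) (Γ := Γ) ℓ) {c : Novikov K Γ} (hc : c ≠ 0)
    (x : V) : ℓ (c • x) = ℓ x - (((c : HahnSeries Γ K).order : ℝ) : EReal) := by
  rw [hF.smul, valuation_of_ne_zero hc]

theorem smul_le_smul (hF : IsFiltration (K := K) (Γ := Γ) ℓ) (c : Novikov K Γ) {x y : V}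
    (h : ℓ x ≤ ℓ y) : ℓ (c • x) ≤ ℓ (c • y) := by
  rw [hF.smul, hF.smul]
  exact EReal.sub_le_sub h le_rfl

theorem neg (hF : IsFiltration (K := K) (Γ := Γ) ℓ) (x : V) : ℓ (-x) = ℓ x := by
  have h : valuation (-1 : Novikov K Γ) = 0 := by
    rw [valuation_of_ne_zero (by simp)]
    simp
  rw [← neg_one_smul (Novikov K Γ) x, hF.smul, h, sub_zero]

theorem sub_le (hF : IsFiltration (K := K) (Γ := Γ) ℓ) (x y : V) :
    ℓ (x - y) ≤ max (ℓ x) (ℓ y) := by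
  rw [sub_eq_add_neg, ← hF.neg y]
  exact hF.add_le _ _

theorem sum_le (hF : IsFiltration (K := K) (Γ := Γ) ℓ) {ι : Type*} (s : Finset ι) (f : ι → V)
    {r : EReal} (h : ∀ i ∈ s, ℓ (f i) ≤ r) : ℓ (∑ i ∈ s, f i) ≤ r := by
  classical
  induction s using Finset.induction_on with
  | empty => simp [hF.zero]
  | insert a s ha ih =>
    rw [Finset.sum_insert ha]
    exact (hF.add_le _ _).trans (max_le (h a (by simp)) (ih fun i hi => h i (by simp [hi])))

theorem restrict (hF : IsFiltration (K := K) (Γ := Γ) ℓ) (U : Submodule (Novikov K Γ) V) :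
    IsFiltration (K := K) (Γ := Γ) fun z : U => ℓ z where
  ne_top x := hF.ne_top x
  eq_bot_iff x := by rw [hF.eq_bot_iff]; simp
  smul c x := hF.smul c x
  add_le x y := hF.add_le x y

end IsFiltration

/-- The upper bound in orthogonality is the ultrametric inequality, so only the lower bound by each
term needs to be checked. -/
theorem isOrthogonal_iff (hF : IsFiltration (K := K) (Γ := Γ) ℓ) {ι : Type*} [Fintype ι]
    {w : ι → V} : IsOrthogonal (K := K) (Γ := Γ) ℓ w ↔
      ∀ (c : ι → Novikov K Γ) (i : ι), ℓ (c i • w i) ≤ ℓ (∑ i, c i • w i) := by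
  refine ⟨fun h c i => ?_, fun h c => le_antisymm ?_ ?_⟩
  · rw [h c]
    exact Finset.le_sup (f := fun i => ℓ (c i • w i)) (Finset.mem_univ i)
  · exact hF.sum_le _ _ fun i _ =>
      Finset.le_sup (f := fun i => ℓ (c i • w i)) (Finset.mem_univ i)
  · exact Finset.sup_le fun i _ => h c i

theorem IsOrthogonal.linearIndependent {ι : Type*} [Fintype ι] {w : ι → V}
    (hw : IsOrthogonal (K := K) (Γ := Γ) ℓ w) (hF : IsFiltration (K := K) (Γ := Γ) ℓ)
    (h0 : ∀ i, w i ≠ 0) : LinearIndependent (Novikov K Γ) w := by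
  rw [Fintype.linearIndependent_iff]
  intro c hc i
  have := (isOrthogonal_iff hF).1 hw c i
  rw [hc, hF.zero, le_bot_iff, hF.eq_bot_iff, smul_eq_zero] at this
  exact this.resolve_right (h0 i)

theorem IsOrthogonal.reindex {ι κ : Type*} [Fintype ι] [Fintype κ] {w : ι → V}
    (hw : IsOrthogonal (K := K) (Γ := Γ) ℓ w) (hF : IsFiltration (K := K) (Γ := Γ) ℓ)
    (e : κ ≃ ι) : IsOrthogonal (K := K) (Γ := Γ) ℓ (w ∘ e) := by
  rw [isOrthogonal_iff hF] at hw ⊢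
  intro c i
  have := hw (c ∘ e.symm) (e i)
  rw [← Equiv.sum_comp e] at this
  simpa using this

theorem IsOrthogonal.smul {ι : Type*} [Fintype ι] {w : ι → V}
    (hw : IsOrthogonal (K := K) (Γ := Γ) ℓ w) (hF : IsFiltration (K := K) (Γ := Γ) ℓ)
    (a : ι → Novikov K Γ) : IsOrthogonal (K := K) (Γ := Γ) ℓ fun i => a i • w i := by
  rw [isOrthogonal_iff hF] at hw ⊢
  intro c i
  simpa [smul_smul] using hw (fun i => c i * a i) i

theorem IsOrthogonal.subfamily {ι κ : Type*} [Fintype ι] [Fintype κ] {w : ι → V}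
    (hw : IsOrthogonal (K := K) (Γ := Γ) ℓ w) (hF : IsFiltration (K := K) (Γ := Γ) ℓ)
    (e : κ → ι) (he : Function.Injective e) : IsOrthogonal (K := K) (Γ := Γ) ℓ (w ∘ e) := by
  classical
  rw [isOrthogonal_iff hF] at hw ⊢
  intro c i
  have key : ∀ j, Function.extend e c 0 (e j) = c j := fun j => he.extend_apply c 0 j
  have := hw (Function.extend e c 0) (e i)
  have hs : ∑ j, Function.extend e c 0 j • w j = ∑ j, c j • (w ∘ e) j := by
    symm
    refine Fintype.sum_of_injective e he _ _ (fun j hj => ?_) fun j => by simp [key]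
    rw [Function.extend_apply' _ _ _ (by simpa using hj)]
    simp
  rw [hs, key] at this
  exact this

/-- Adjoining a vector orthogonal to the span of an orthogonal family. -/
theorem IsOrthogonal.option {ι : Type*} [Fintype ι] {w : ι → V}
    (hw : IsOrthogonal (K := K) (Γ := Γ) ℓ w) (hF : IsFiltration (K := K) (Γ := Γ) ℓ) {x : V}
    (hx : ∀ c : Novikov K Γ, ∀ z ∈ Submodule.span (Novikov K Γ) (Set.range w),
      ℓ (c • x) ≤ ℓ (c • x + z)) :
    IsOrthogonal (K := K) (Γ := Γ) ℓ fun o : Option ι => o.elim x w := by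
  have hw' := (isOrthogonal_iff hF).1 hw
  rw [isOrthogonal_iff hF]
  intro c o
  rw [Fintype.sum_option]
  set z := ∑ i, c (some i) • w i with hz
  have hzs : z ∈ Submodule.span (Novikov K Γ) (Set.range w) :=
    Submodule.sum_mem _ fun i _ => Submodule.smul_mem _ _ (Submodule.subset_span ⟨i, rfl⟩)
  have h1 := hx (c none) z hzs
  cases o with
  | none => exact h1
  | some i =>
    refine (hw' (fun i => c (some i)) i).trans ?_
    have : ∑ i, c (some i) • w i = (c none • x + z) - c none • x := by rw [← hz]; abel
    rw [this]
    exact (hF.sub_le _ _).trans (max_le le_rfl h1)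

end Filtration

/-! ### Existence of singular value decompositions -/

section SVD

variable {K : Type u} [Field K] {Γ : AddSubgroup ℝ}
variable {V : Type v} [AddCommGroup V] [Module (Novikov K Γ) V] {ℓ : V → EReal}
variable {W : Type v} [AddCommGroup W] [Module (Novikov K Γ) W] {ℓ' : W → EReal}

theorem span_range_option {ι : Type*} (x : V) (w : ι → V) :
    Submodule.span (Novikov K Γ) (Set.range fun o : Option ι => o.elim x w) =
      Submodule.span (Novikov K Γ) {x} ⊔ Submodule.span (Novikov K Γ) (Set.range w) := by
  rw [← Submodule.span_union]
  congr 1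
  ext z
  simp [Option.exists, eq_comm]

theorem exists_pivot {ι : Type*} [Fintype ι] {w : ι → V} (c : ι → Novikov K Γ)
    (hF : IsFiltration (K := K) (Γ := Γ) ℓ) (hw : IsOrthogonal (K := K) (Γ := Γ) ℓ w)
    (hx : ∑ i, c i • w i ≠ 0) : ∃ i, ℓ (∑ i, c i • w i) = ℓ (c i • w i) ∧ c i ≠ 0 := by
  have hne : (Finset.univ : Finset ι).Nonempty := by
    by_contra h
    rw [Finset.not_nonempty_iff_eq_empty] at h
    exact hx (by rw [h, Finset.sum_empty])
  obtain ⟨i, -, hi⟩ := Finset.exists_mem_eq_sup Finset.univ hne fun i => ℓ (c i • w i)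
  rw [← hw c] at hi
  refine ⟨i, hi, fun h => hx ?_⟩
  rw [← hF.eq_bot_iff, hi, h, zero_smul, hF.zero]

/-- If the level of `∑ i, c i • w i` is attained at the index `p`, then this vector is orthogonal
to the vectors whose coordinate at `p` vanishes. -/
theorem le_add_of_pivot {ι : Type*} [Fintype ι] {w : ι → V} {c d : ι → Novikov K Γ} {p : ι}
    (hF : IsFiltration (K := K) (Γ := Γ) ℓ) (hw : IsOrthogonal (K := K) (Γ := Γ) ℓ w)
    (hp : ℓ (∑ i, c i • w i) = ℓ (c p • w p)) (hd : d p = 0) (a : Novikov K Γ) :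
    ℓ (a • ∑ i, c i • w i) ≤ ℓ (a • (∑ i, c i • w i) + ∑ i, d i • w i) := by
  have h1 := (isOrthogonal_iff hF).1 hw (fun i => a * c i + d i) p
  have h2 : ∑ i, (a * c i + d i) • w i = a • (∑ i, c i • w i) + ∑ i, d i • w i := by
    simp only [add_smul, mul_smul, Finset.sum_add_distrib, Finset.smul_sum]
  rw [h2, hd, add_zero, mul_smul] at h1
  exact (hF.smul_le_smul a hp.le).trans h1

/-- Induction on the dimension of `U`. The level of a nonzero `x ∈ U` is attained at some coordinate
`p`; by `le_add_of_pivot` the vector `x` is orthogonal to the part of `U` where that coordinate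
vanishes, and together they span `U`. -/
theorem exists_orthogonal_family {ι : Type} [Fintype ι]
    (hF : IsFiltration (K := K) (Γ := Γ) ℓ) (b : Module.Basis ι (Novikov K Γ) V)
    (hb : IsOrthogonal (K := K) (Γ := Γ) ℓ b) (n : ℕ) :
    ∀ U : Submodule (Novikov K Γ) V, Module.finrank (Novikov K Γ) U = n →
      ∃ (κ : Type) (_ : Fintype κ) (w : κ → V), IsOrthogonal (K := K) (Γ := Γ) ℓ w ∧
        (∀ i, w i ≠ 0) ∧ Submodule.span (Novikov K Γ) (Set.range w) = U := by
  have : Module.Finite (Novikov K Γ) V := Module.Finite.of_basis b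
  induction n using Nat.strong_induction_on with
  | _ n ih =>
  intro U hU
  by_cases hU0 : U = ⊥
  · refine ⟨Empty, inferInstance, Empty.elim, ?_, fun i => i.elim, ?_⟩
    · rw [isOrthogonal_iff hF]
      exact fun _ i => i.elim
    · rw [hU0, Set.range_eq_empty, Submodule.span_empty]
  obtain ⟨x, hxU, hx0⟩ := U.ne_bot_iff.1 hU0
  have hx : ∑ i, b.repr x i • b i = x := b.sum_repr x
  obtain ⟨p, hp, hp0⟩ := exists_pivot (b.repr x) hF hb (by rwa [hx])
  set U' : Submodule (Novikov K Γ) V := U ⊓ LinearMap.ker (b.coord p) with hU'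
  have hlt : U' < U := by
    refine lt_of_le_of_ne inf_le_left fun h => ?_
    have : x ∈ U' := by rw [h]; exact hxU
    exact hp0 this.2
  obtain ⟨κ, _, w, hw, hw0, hwU⟩ := ih _ (hU ▸ Submodule.finrank_lt_finrank_of_lt hlt) U' rfl
  refine ⟨Option κ, inferInstance, fun o => o.elim x w, hw.option hF ?_, ?_, ?_⟩
  · intro c z hz
    rw [hwU] at hz
    have h := le_add_of_pivot hF hb (d := b.repr z) hp hz.2 c
    rw [b.sum_repr, b.sum_repr] at h
    exact h
  · rintro (_ | i)
    · exact hx0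
    · exact hw0 i
  · rw [span_range_option, hwU]
    apply le_antisymm
    · exact sup_le ((Submodule.span_singleton_le_iff_mem _ _).2 hxU) inf_le_left
    · intro z hz
      set a := b.repr z p / b.repr x p
      have : z = a • x + (z - a • x) := by abel
      rw [this]
      refine Submodule.add_mem_sup (Submodule.smul_mem _ _ (Submodule.mem_span_singleton_self x))
        ⟨U.sub_mem hz (U.smul_mem _ hxU), ?_⟩
      simp [a, div_mul_cancel₀ _ hp0]

theorem sum_dite_smul {ι : Type*} [Fintype ι] [DecidableEq ι] (q : ι)
    (c : {j // j ≠ q} → Novikov K Γ) (f : ι → V) :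
    ∑ j, (if h : j ≠ q then c ⟨j, h⟩ else 0) • f j = ∑ j : {j // j ≠ q}, c j • f j := by
  symm
  refine Fintype.sum_of_injective Subtype.val Subtype.val_injective _ _ ?_ ?_
  · intro j hj
    have : j = q := by simpa using hj
    simp [this]
  · intro j
    simp [j.2]

/-- Subtracting from the members of an orthogonal family multiples of the member `v q` of at most
the same level. -/
theorem IsOrthogonal.eliminate {ι : Type*} [Fintype ι] [DecidableEq ι] {v : ι → V}
    (hF : IsFiltration (K := K) (Γ := Γ) ℓ) (hv : IsOrthogonal (K := K) (Γ := Γ) ℓ v)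
    (hv0 : ∀ j, v j ≠ 0) (q : ι) (t : ι → Novikov K Γ) (htle : ∀ j, ℓ (t j • v q) ≤ ℓ (v j)) :
    IsOrthogonal (K := K) (Γ := Γ) ℓ (fun j : {j // j ≠ q} => v j - t j • v q) ∧
    (∀ j : {j // j ≠ q}, v j - t j • v q ≠ 0) ∧
    ∀ (d : Novikov K Γ) (c : {j // j ≠ q} → Novikov K Γ),
      ℓ (d • v q) ≤ ℓ (d • v q + ∑ j : {j // j ≠ q}, c j • (v j - t j • v q)) := by
  let v' : {j // j ≠ q} → V := fun j => v j - t j • v q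
  have hexp : ∀ (d : Novikov K Γ) (c : {j // j ≠ q} → Novikov K Γ),
      d • v q + ∑ j, c j • v' j =
        ∑ j, (if h : j ≠ q then c ⟨j, h⟩ else d - ∑ j, c j * t j) • v j := by
    intro d c
    have h1 : ∀ j, (if h : j ≠ q then c ⟨j, h⟩ else d - ∑ j, c j * t j) • v j =
        (if h : j ≠ q then c ⟨j, h⟩ else 0) • v j +
          if j = q then (d - ∑ j, c j * t j) • v q else 0 := by
      intro j
      by_cases h : j = q
      · subst h; simp
      · simp [h]
    rw [Finset.sum_congr rfl fun j _ => h1 j, Finset.sum_add_distrib, sum_dite_smul]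
    simp only [v', smul_sub, Finset.sum_sub_distrib, Finset.sum_ite_eq', Finset.mem_univ,
      if_true, sub_smul, Finset.sum_smul, smul_smul]
    abel
  have hle' : ∀ (d : Novikov K Γ) (c : {j // j ≠ q} → Novikov K Γ) (j : {j // j ≠ q}),
      ℓ (c j • v j) ≤ ℓ (d • v q + ∑ j, c j • v' j) := by
    intro d c j
    rw [hexp]
    have := (isOrthogonal_iff hF).1 hv
      (fun j => if h : j ≠ q then c ⟨j, h⟩ else d - ∑ j, c j * t j) j
    simpa [j.2] using this
  have hle : ∀ (d : Novikov K Γ) (c : {j // j ≠ q} → Novikov K Γ),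
      ℓ (d • v q) ≤ ℓ (d • v q + ∑ j, c j • v' j) := by
    intro d c
    -- Expanded in the original family, the coefficient of `v q` is `d - ∑ c j * t j`. The
    -- correction is harmless because `c j • t j • v q` never exceeds the level of `c j • v j`.
    have h1 : d • v q = (d - ∑ j, c j * t j) • v q + ∑ j, c j • t j • v q := by
      simp only [sub_smul, Finset.sum_smul, smul_smul]
      abel
    conv_lhs => rw [h1]
    refine (hF.add_le _ _).trans (max_le ?_ (hF.sum_le _ _ fun j _ => ?_))
    · rw [hexp]
      have := (isOrthogonal_iff hF).1 hv
        (fun j => if h : j ≠ q then c ⟨j, h⟩ else d - ∑ j, c j * t j) q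
      simpa using this
    · exact (hF.smul_le_smul _ (htle j)).trans (hle' d c j)
  have hv'le : ∀ j : {j // j ≠ q}, ℓ (v' j) ≤ ℓ (v j) := fun j =>
    (hF.sub_le _ _).trans (max_le le_rfl (htle j))
  have hv' : IsOrthogonal (K := K) (Γ := Γ) ℓ v' := by
    rw [isOrthogonal_iff hF]
    intro c j
    refine (hF.smul_le_smul _ (hv'le j)).trans ?_
    have := hle' 0 c j
    rwa [zero_smul, zero_add] at this
  have hv'0 : ∀ j, v' j ≠ 0 := by
    intro j hj
    have := hle' 0 (Pi.single j 1) j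
    rw [Finset.sum_eq_single j (by intro i _ hi; simp [hi]) (by simp)] at this
    simp only [Pi.single_eq_same, one_smul, zero_smul, zero_add, hj, hF.zero, le_bot_iff] at this
    exact hv0 _ ((hF.eq_bot_iff _).1 this)
  exact ⟨hv', hv'0, hle⟩

/-- Gaussian elimination. The pair split off is `v q`, `A (v q)` for the `q` at which `A` lowers the
level least. A coordinate `p` at which the level of `A (v q)` is attained is cleared from every
other `A (v j)` by subtracting a multiple of `v q`; the choice of `q` keeps this multiple at or
below the level of `v j`, so orthogonality survives. Families with prescribed spans are used instead
of bases because what remains after removing `q` and `p` spans only a subspace. -/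
theorem exists_singular_families (hF : IsFiltration (K := K) (Γ := Γ) ℓ)
    (hF' : IsFiltration (K := K) (Γ := Γ) ℓ') (A : V →ₗ[Novikov K Γ] W) (n : ℕ) :
    ∀ (ι κ : Type) [Fintype ι] [Fintype κ] (v : ι → V) (w : κ → W), Fintype.card ι = n →
      IsOrthogonal (K := K) (Γ := Γ) ℓ v → IsOrthogonal (K := K) (Γ := Γ) ℓ' w →
      (∀ j, v j ≠ 0) → (∀ i, w i ≠ 0) →
      (∀ j, A (v j) ∈ Submodule.span (Novikov K Γ) (Set.range w)) →
      ∃ (ρ π θ : Type) (_ : Fintype ρ) (_ : Fintype π) (_ : Fintype θ)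
        (y : ρ ⊕ π → V) (x : ρ ⊕ θ → W),
        IsOrthogonal (K := K) (Γ := Γ) ℓ y ∧ IsOrthogonal (K := K) (Γ := Γ) ℓ' x ∧
        (∀ j, y j ≠ 0) ∧ (∀ i, x i ≠ 0) ∧
        Submodule.span (Novikov K Γ) (Set.range y) = Submodule.span (Novikov K Γ) (Set.range v) ∧
        Submodule.span (Novikov K Γ) (Set.range x) = Submodule.span (Novikov K Γ) (Set.range w) ∧
        (∀ i, A (y (Sum.inl i)) = x (Sum.inl i)) ∧ ∀ i, A (y (Sum.inr i)) = 0 := by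
  classical
  induction n with
  | zero =>
    intro ι κ _ _ v w hn hv hw hv0 hw0 hA
    have : IsEmpty ι := Fintype.card_eq_zero_iff.1 hn
    let e : Empty ⊕ ι ≃ ι := Equiv.emptySum Empty ι
    let e' : Empty ⊕ κ ≃ κ := Equiv.emptySum Empty κ
    exact ⟨Empty, ι, κ, inferInstance, inferInstance, inferInstance, v ∘ e, w ∘ e',
      hv.reindex hF e, hw.reindex hF' e', fun j => hv0 _, fun j => hw0 _,
      by rw [e.surjective.range_comp], by rw [e'.surjective.range_comp], fun i => i.elim,
      fun i => isEmptyElim i⟩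
  | succ n ih =>
    intro ι κ _ _ v w hn hv hw hv0 hw0 hA
    by_cases hzero : ∀ j, A (v j) = 0
    · let e : Empty ⊕ ι ≃ ι := Equiv.emptySum Empty ι
      let e' : Empty ⊕ κ ≃ κ := Equiv.emptySum Empty κ
      exact ⟨Empty, ι, κ, inferInstance, inferInstance, inferInstance, v ∘ e, w ∘ e',
        hv.reindex hF e, hw.reindex hF' e', fun j => hv0 _, fun j => hw0 _,
        by rw [e.surjective.range_comp], by rw [e'.surjective.range_comp], fun i => i.elim,
        fun i => hzero i⟩
    push Not at hzero
    obtain ⟨q, hq, hqmax⟩ := Finset.exists_max_image (Finset.univ.filter fun j => A (v j) ≠ 0)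
      (fun j => (ℓ' (A (v j))).toReal - (ℓ (v j)).toReal)
      (by obtain ⟨j, hj⟩ := hzero; exact ⟨j, by simpa using hj⟩)
    simp only [Finset.mem_filter, Finset.mem_univ, true_and] at hq hqmax
    have hA' : ∀ j, ∃ c : κ → Novikov K Γ, ∑ i, c i • w i = A (v j) := fun j =>
      (Submodule.mem_span_range_iff_exists_fun _).1 (hA j)
    choose a ha using hA'
    obtain ⟨p, hp, hp0⟩ := exists_pivot (a q) hF' hw (by rwa [ha])
    rw [ha] at hp
    set t : ι → Novikov K Γ := fun j => a j p / a q p with ht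
    -- the elimination does not raise levels
    have htle : ∀ j, ℓ (t j • v q) ≤ ℓ (v j) := by
      intro j
      by_cases hj : a j p = 0
      · simp [ht, hj, hF.zero]
      have htj : t j ≠ 0 := div_ne_zero hj hp0
      have hAj : A (v j) ≠ 0 := by
        intro h0
        have := (isOrthogonal_iff hF').1 hw (a j) p
        rw [ha, h0, hF'.zero, le_bot_iff, hF'.eq_bot_iff, smul_eq_zero] at this
        exact this.elim hj (hw0 p)
      have h1 := hqmax j hAj
      have h2 : ℓ' (t j • A (v q)) ≤ ℓ' (A (v j)) := by
        refine (hF'.smul_le_smul (t j) hp.le).trans ?_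
        rw [smul_smul, ht, div_mul_cancel₀ _ hp0]
        have := (isOrthogonal_iff hF').1 hw (a j) p
        rwa [ha] at this
      rw [hF'.smul_of_ne_zero htj, ← hF'.coe_toReal hq, ← hF'.coe_toReal hAj] at h2
      rw [hF.smul_of_ne_zero htj, ← hF.coe_toReal (hv0 q), ← hF.coe_toReal (hv0 j)]
      norm_cast at h2 ⊢
      linarith
    let v' : {j // j ≠ q} → V := fun j => v j - t j • v q
    let w' : {i // i ≠ p} → W := fun i => w i
    obtain ⟨hv', hv'0, hle⟩ := hv.eliminate hF hv0 q t htle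
    have hw' : IsOrthogonal (K := K) (Γ := Γ) ℓ' w' :=
      hw.subfamily hF' Subtype.val Subtype.val_injective
    have hsumw : ∀ c : κ → Novikov K Γ, c p = 0 → ∑ i, c i • w i ∈
        Submodule.span (Novikov K Γ) (Set.range w') := by
      intro c hc
      refine Submodule.sum_mem _ fun i _ => ?_
      by_cases hi : i = p
      · rw [hi, hc, zero_smul]; exact Submodule.zero_mem _
      · exact Submodule.smul_mem _ _ (Submodule.subset_span ⟨⟨i, hi⟩, rfl⟩)
    have hAv' : ∀ j, A (v' j) ∈ Submodule.span (Novikov K Γ) (Set.range w') := by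
      intro j
      have : A (v' j) = ∑ i, (a j i - t j * a q i) • w i := by
        simp only [v', map_sub, map_smul, sub_smul, mul_smul, Finset.sum_sub_distrib,
          ← Finset.smul_sum, ha]
      rw [this]
      exact hsumw _ (by simp [ht, div_mul_cancel₀ _ hp0])
    obtain ⟨ρ, π, θ, _, _, _, y, x, hy, hx, hy0, hx0, hys, hxs, hyx, hyz⟩ :=
      ih {j // j ≠ q} {i // i ≠ p} v' w' (by simp [hn]) hv' hw' hv'0
        (fun i => hw0 _) hAv'
    let e : ∀ τ : Type, Option ρ ⊕ τ ≃ Option (ρ ⊕ τ) := fun τ =>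
      { toFun := Sum.elim (fun o => o.map Sum.inl) fun t => some (Sum.inr t)
        invFun := fun o => o.elim (Sum.inl none) (Sum.elim (fun r => Sum.inl (some r)) Sum.inr)
        left_inv := by rintro ((_ | _) | _) <;> rfl
        right_inv := by rintro (_ | (_ | _)) <;> rfl }
    refine ⟨Option ρ, π, θ, inferInstance, inferInstance, inferInstance,
      (fun o : Option (ρ ⊕ π) => o.elim (v q) y) ∘ e π,
      (fun o : Option (ρ ⊕ θ) => o.elim (A (v q)) x) ∘ e θ,
      (hy.option hF ?_).reindex hF _, (hx.option hF' ?_).reindex hF' _, ?_, ?_, ?_, ?_, ?_, ?_⟩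
    · intro c z hz
      rw [hys] at hz
      obtain ⟨d, rfl⟩ := (Submodule.mem_span_range_iff_exists_fun _).1 hz
      exact hle c d
    · intro c z hz
      rw [hxs] at hz
      obtain ⟨d, rfl⟩ := (Submodule.mem_span_range_iff_exists_fun _).1 hz
      have h := le_add_of_pivot hF' hw (c := a q)
        (d := fun i => if h : i ≠ p then d ⟨i, h⟩ else 0) (by rw [ha]; exact hp) (by simp) c
      rw [ha, sum_dite_smul] at h
      exact h
    · rintro ((_ | i) | i)
      · exact hv0 q
      · exact hy0 _
      · exact hy0 _
    · rintro ((_ | i) | i)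
      · exact hq
      · exact hx0 _
      · exact hx0 _
    · rw [(e π).surjective.range_comp, span_range_option, hys]
      apply le_antisymm
      · refine sup_le ((Submodule.span_singleton_le_iff_mem _ _).2
          (Submodule.subset_span ⟨q, rfl⟩)) (Submodule.span_le.2 ?_)
        rintro _ ⟨j, rfl⟩
        exact Submodule.sub_mem _ (Submodule.subset_span ⟨j, rfl⟩)
          (Submodule.smul_mem _ _ (Submodule.subset_span ⟨q, rfl⟩))
      · rw [Submodule.span_le]
        rintro _ ⟨j, rfl⟩
        by_cases hj : j = q
        · rw [hj]
          exact Submodule.mem_sup_left (Submodule.mem_span_singleton_self _)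
        · have : v j = t j • v q + v' ⟨j, hj⟩ := by simp [v']
          rw [this]
          exact Submodule.add_mem_sup
            (Submodule.smul_mem _ _ (Submodule.mem_span_singleton_self _))
            (Submodule.subset_span ⟨_, rfl⟩)
    · rw [(e θ).surjective.range_comp, span_range_option, hxs]
      apply le_antisymm
      · refine sup_le ((Submodule.span_singleton_le_iff_mem _ _).2 (hA q))
          (Submodule.span_mono ?_)
        rintro _ ⟨i, rfl⟩
        exact ⟨i, rfl⟩
      · rw [Submodule.span_le]
        rintro _ ⟨i, rfl⟩
        by_cases hi : i = p
        -- The expansion of `A (v q)` is solved for `w p`, the pivot coefficient being invertible;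
        -- the remainder has no component at `p`.
        · have h1 : w p = (a q p)⁻¹ • A (v q) +
              ∑ i, ((if i = p then 1 else 0) - (a q p)⁻¹ * a q i) • w i := by
            simp only [sub_smul, Finset.sum_sub_distrib, ite_smul, one_smul, zero_smul,
              Finset.sum_ite_eq', Finset.mem_univ, if_true, mul_smul, ← Finset.smul_sum, ha]
            abel
          rw [hi, h1]
          exact Submodule.add_mem_sup
            (Submodule.smul_mem _ _ (Submodule.mem_span_singleton_self _))
            (hsumw _ (by simp [hp0]))
        · exact Submodule.mem_sup_right (Submodule.subset_span ⟨⟨i, hi⟩, rfl⟩)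
    · rintro (_ | i)
      · rfl
      · exact hyx i
    · intro i
      exact hyz i

theorem IsOrthogonalizable.submodule (h : IsOrthogonalizable (K := K) (Γ := Γ) ℓ)
    (U : Submodule (Novikov K Γ) V) :
    IsOrthogonalizable (K := K) (Γ := Γ) fun z : U => ℓ z := by
  have hF := h.isFiltration
  refine ⟨hF.restrict U, ?_⟩
  obtain ⟨n, b, hb⟩ := h.exists_basis
  obtain ⟨κ, _, w, hw, hw0, hwU⟩ := exists_orthogonal_family hF b hb _ U rfl
  have hli := hw.linearIndependent hF hw0
  let e := (Fintype.equivFin κ).symm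
  let B := ((Module.Basis.span hli).map (LinearEquiv.ofEq _ _ hwU)).reindex e.symm
  refine ⟨Fintype.card κ, B, (isOrthogonal_iff (hF.restrict U)).2 ?_⟩
  have hB : ∀ i, (B i : V) = (w ∘ e) i := by
    intro i
    simp [B, Module.Basis.span_apply]
  have := (isOrthogonal_iff hF).1 (hw.reindex hF e)
  intro c i
  simpa [hB] using this c i

theorem exists_svd (hV : IsOrthogonalizable (K := K) (Γ := Γ) ℓ)
    (hW : IsOrthogonalizable (K := K) (Γ := Γ) ℓ') (A : V →ₗ[Novikov K Γ] W) :
    Nonempty (SVD ℓ ℓ' A) := by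
  have hF := hV.isFiltration
  have hF' := hW.isFiltration
  obtain ⟨n, b, hb⟩ := hV.exists_basis
  obtain ⟨m, b', hb'⟩ := hW.exists_basis
  obtain ⟨ρ, π, θ, _, _, _, y, x, hy, hx, hy0, hx0, hys, hxs, hyx, hyz⟩ :=
    exists_singular_families hF hF' A n (Fin n) (Fin m) b b' (by simp) hb hb'
      (fun i => b.ne_zero i) (fun i => b'.ne_zero i) (fun j => by rw [b'.span_eq]; trivial)
  rw [b.span_eq] at hys
  rw [b'.span_eq] at hxs
  let eρ := (Fintype.equivFin ρ).symm
  let f : Fin (Fintype.card ρ) → EReal := fun i =>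
    ℓ (y (Sum.inl (eρ i))) - ℓ' (x (Sum.inl (eρ i)))
  -- `Tuple.sort` sorts increasingly; the order dual turns this into the decreasing order required
  -- of the differences of levels.
  let σ := Tuple.sort (OrderDual.toDual ∘ f)
  have hσ : Antitone (f ∘ σ) := by
    have := Tuple.monotone_sort (OrderDual.toDual ∘ f)
    intro i j hij
    exact this hij
  let e := σ.trans eρ
  let ey := Equiv.sumCongr e (Fintype.equivFin π).symm
  let ex := Equiv.sumCongr e (Fintype.equivFin θ).symm
  let By := (Module.Basis.mk (hy.linearIndependent hF hy0) hys.ge).reindex ey.symm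
  let Bx := (Module.Basis.mk (hx.linearIndependent hF' hx0) hxs.ge).reindex ex.symm
  have hBy : ∀ i, By i = (y ∘ ey) i := fun i => by simp [By]
  have hBx : ∀ i, Bx i = (x ∘ ex) i := fun i => by simp [Bx]
  have hmap : ∀ i, A (By (Sum.inl i)) = Bx (Sum.inl i) := fun i => by
    rw [hBy, hBx]; exact hyx _
  have hmap0 : ∀ i, A (By (Sum.inr i)) = 0 := fun i => by
    rw [hBy]; exact hyz _
  have hAv : ∀ z, A z = ∑ i, By.repr z (Sum.inl i) • Bx (Sum.inl i) := by
    intro z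
    conv_lhs => rw [← By.sum_repr z, Fintype.sum_sum_type]
    simp only [map_add, map_sum, map_smul, hmap, hmap0, smul_zero, Finset.sum_const_zero, add_zero]
  refine ⟨⟨_, _, _, By, Bx, ?_, ?_, ?_, ?_, hmap, ?_⟩⟩
  · have : (By : _ → V) = y ∘ ey := funext hBy
    rw [this]
    exact hy.reindex hF _
  · have : (Bx : _ → W) = x ∘ ex := funext hBx
    rw [this]
    exact hx.reindex hF' _
  · apply le_antisymm
    · rw [Submodule.span_le]
      rintro _ ⟨i, rfl⟩
      exact hmap0 i
    · intro z hz
      rw [LinearMap.mem_ker, hAv] at hz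
      have hli := (Fintype.linearIndependent_iff.1
        (Bx.linearIndependent.comp Sum.inl Sum.inl_injective)) _ hz
      rw [← By.sum_repr z, Fintype.sum_sum_type]
      simp only [hli, zero_smul, Finset.sum_const_zero, zero_add]
      exact Submodule.sum_mem _ fun i _ =>
        Submodule.smul_mem _ _ (Submodule.subset_span ⟨i, rfl⟩)
  · apply le_antisymm
    · rw [Submodule.span_le]
      rintro _ ⟨i, rfl⟩
      exact ⟨_, hmap i⟩
    · rintro _ ⟨z, rfl⟩
      rw [hAv]
      exact Submodule.sum_mem _ fun i _ =>
        Submodule.smul_mem _ _ (Submodule.subset_span ⟨i, rfl⟩)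
  · have : (fun i => ℓ (By (Sum.inl i)) - ℓ' (Bx (Sum.inl i))) = f ∘ σ := by
      funext i
      simp [hBy, hBx, f, ey, ex, e]
    rw [this]
    exact hσ

end SVD

theorem FloerComplex.nonempty_boundarySVD {K : Type u} [Field K] {Γ : AddSubgroup ℝ}
    (C : FloerComplex.{u, v} K Γ) (k : ℤ) : Nonempty (C.BoundarySVD k) :=
  exists_svd (C.orthogonalizable (k + 1)) ((C.orthogonalizable k).submodule (C.cycles k))
    (C.boundary k)

/-! ### Hall's theorem and matrices with bounded valuations -/

section Hall

variable {K : Type u} [Field K] {Γ : AddSubgroup ℝ}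

theorem valuation_neg (x : Novikov K Γ) : valuation (-x) = valuation x := by
  by_cases hx : x = 0
  · simp [hx]
  · rw [valuation_of_ne_zero hx, valuation_of_ne_zero (neg_ne_zero.2 hx)]
    simp

variable (Γ) in
/-- Up to a translation by `Γ`, the endpoints of two intervals are `δ`-close. -/
def IntervalClose (δ a b a' b' : ℝ) : Prop :=
  ∃ g : Γ, |a' - g - a| ≤ δ ∧ |b' - g - b| ≤ δ

theorem IntervalClose.symm {δ a b a' b' : ℝ} (h : IntervalClose Γ δ a b a' b') :
    IntervalClose Γ δ a' b' a b := by
  obtain ⟨g, h1, h2⟩ := h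
  refine ⟨-g, ?_, ?_⟩
  · rw [abs_sub_comm] at h1
    convert h1 using 2
    push_cast; ring
  · rw [abs_sub_comm] at h2
    convert h2 using 2
    push_cast; ring

/-- Suppose the valuation `g` of `x` were at most the difference of midpoints. The hypotheses bound
`a' - g - a` and `b' - g - b` above by `δ`, and their sum would be nonnegative, so both would lie in
`[-δ, δ]` and `g` would witness closeness. -/
theorem lt_valuation_of_not_close {δ a b a' b' : ℝ} {x : Novikov K Γ}
    (h : ¬ IntervalClose Γ δ a b a' b') (ha : ((a' - a - δ : ℝ) : EReal) ≤ valuation x)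
    (hb : ((b' - b - δ : ℝ) : EReal) ≤ valuation x) :
    (((a' + b') / 2 - (a + b) / 2 : ℝ) : EReal) < valuation x := by
  by_cases hx : x = 0
  · rw [hx, valuation_zero]; exact EReal.coe_lt_top _
  rw [valuation_of_ne_zero hx, EReal.coe_le_coe_iff] at ha hb
  rw [valuation_of_ne_zero hx, EReal.coe_lt_coe_iff]
  by_contra hlt
  refine h ⟨(x : HahnSeries Γ K).order, ?_, ?_⟩ <;> rw [abs_le] <;> constructor <;> linarith

/-- Hall's condition is checked by contradiction: a set `s` with too few close partners gives a
nonzero vector supported on `s` and annihilated by the rows of `φ` at those partners. Applying `ψ`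
to its image under `φ` nearly returns the vector, yet all contributions have too large a valuation.
-/
theorem exists_injective_close {I J : Type} [Fintype I] [Fintype J] {a b : I → ℝ} {a' b' : J → ℝ}
    {φ : J → I → Novikov K Γ} {ψ : I → J → Novikov K Γ} {δ : ℝ} [DecidableEq I]
    (hφa : ∀ j i, ((a' j - a i - δ : ℝ) : EReal) ≤ valuation (φ j i))
    (hφb : ∀ j i, ((b' j - b i - δ : ℝ) : EReal) ≤ valuation (φ j i))
    (hψa : ∀ i j, ((a i - a' j - δ : ℝ) : EReal) ≤ valuation (ψ i j))
    (hψb : ∀ i j, ((b i - b' j - δ : ℝ) : EReal) ≤ valuation (ψ i j))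
    (hκ : ∀ i' i, (((a i' + b i') / 2 - (a i + b i) / 2 : ℝ) : EReal) <
      valuation (∑ j, ψ i' j * φ j i - if i' = i then 1 else 0)) :
    ∃ f : I → J, Function.Injective f ∧
      ∀ i, IntervalClose Γ δ (a i) (b i) (a' (f i)) (b' (f i)) := by
  classical
  have hall := (Finset.all_card_le_biUnion_card_iff_exists_injective fun i : I =>
    Finset.univ.filter fun j => IntervalClose Γ δ (a i) (b i) (a' j) (b' j)).1
  suffices h : ∀ s : Finset I, s.card ≤ (s.biUnion fun i =>
      Finset.univ.filter fun j => IntervalClose Γ δ (a i) (b i) (a' j) (b' j)).card by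
    obtain ⟨f, hf, hfc⟩ := hall h
    exact ⟨f, hf, fun i => by simpa using hfc i⟩
  intro s
  by_contra! hs
  set N := s.biUnion fun i =>
    Finset.univ.filter fun j => IntervalClose Γ δ (a i) (b i) (a' j) (b' j) with hN
  have hNc : ∀ i ∈ s, ∀ j, j ∉ N → ¬ IntervalClose Γ δ (a i) (b i) (a' j) (b' j) := by
    intro i hi j hj hc
    exact hj (by simpa [hN] using ⟨i, hi, hc⟩)
  let A : (s → Novikov K Γ) →ₗ[Novikov K Γ] (N → Novikov K Γ) :=
    Matrix.toLin' (Matrix.of fun (j : N) (i : s) => φ j i)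
  -- There are more unknowns, indexed by `s`, than equations, indexed by `N`.
  have hker : LinearMap.ker A ≠ ⊥ := LinearMap.ker_ne_bot_of_finrank_lt (by simpa using hs)
  obtain ⟨w, hw, hw0⟩ := (Submodule.ne_bot_iff _).1 hker
  have hwN : ∀ j ∈ N, ∑ i : s, φ j i * w i = 0 := by
    intro j hj
    have := congrFun (LinearMap.mem_ker.1 hw) ⟨j, hj⟩
    simpa [A, Matrix.mulVec, dotProduct] using this
  obtain ⟨i1, hi1⟩ := Function.ne_iff.1 hw0
  -- Subtracting the midpoints makes the entries comparable: strict bounds by differences of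
  -- midpoints then compose along `i → j → p`.
  obtain ⟨p, hp, hpmin⟩ := Finset.exists_min_image (Finset.univ.filter fun i : s => w i ≠ 0)
    (fun i => ((w i : HahnSeries Γ K).order : ℝ) - (a i + b i) / 2) ⟨i1, by simpa using hi1⟩
  simp only [Finset.mem_filter, Finset.mem_univ, true_and] at hp hpmin
  set m : ℝ := ((w p : HahnSeries Γ K).order : ℝ) with hm
  -- a product of `w i` with a small enough factor is smaller than `w p`
  have hsmall : ∀ (i : s) (x : Novikov K Γ),
      (((a p + b p) / 2 - (a i + b i) / 2 : ℝ) : EReal) < valuation x →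
        (m : EReal) < valuation (x * w i) := by
    intro i x hx
    by_cases hx0 : x = 0
    · rw [hx0, zero_mul, valuation_zero]; exact EReal.coe_lt_top _
    by_cases hwi : w i = 0
    · rw [hwi, mul_zero, valuation_zero]; exact EReal.coe_lt_top _
    have := hpmin i hwi
    rw [valuation_of_ne_zero hx0, EReal.coe_lt_coe_iff] at hx
    rw [valuation_mul, valuation_of_ne_zero hx0, valuation_of_ne_zero hwi, ← EReal.coe_add,
      EReal.coe_lt_coe_iff]
    linarith
  -- This is `w = ψφw - (ψφ - 1)w` at the index `p`, with the rows in `N` dropped since `φw`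
  -- vanishes there. Every remaining term has valuation above that of `w p`.
  have key : w p = ∑ j, (if j ∈ N then 0 else ∑ i : s, (ψ p j * φ j i) * w i) +
      -∑ i : s, (∑ j, ψ p j * φ j i - if (p : I) = i then 1 else 0) * w i := by
    have h1 : ∀ j, (if j ∈ N then 0 else ∑ i : s, (ψ p j * φ j i) * w i) =
        ∑ i : s, (ψ p j * φ j i) * w i := by
      intro j
      split_ifs with hj
      · simp only [mul_assoc, ← Finset.mul_sum, hwN j hj, mul_zero]
      · rfl
    have h2 : ∑ i : s, (if (p : I) = i then 1 else 0) * w i = w p := by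
      rw [Finset.sum_eq_single p]
      · simp
      · intro i _ hi
        have : (p : I) ≠ i := fun h => hi (Subtype.ext h.symm)
        simp [this]
      · simp
    rw [Finset.sum_congr rfl fun j _ => h1 j]
    simp only [sub_mul, Finset.sum_sub_distrib, h2, Finset.sum_mul]
    rw [Finset.sum_comm]
    abel
  have hlt : (m : EReal) < valuation (w p) := by
    rw [key]
    refine lt_of_lt_of_le (lt_min ?_ ?_) (min_valuation_le_add _ _)
    · refine lt_valuation_sum _ _ _ fun j _ => ?_
      split_ifs with hj
      · rw [valuation_zero]; exact EReal.coe_lt_top _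
      refine lt_valuation_sum _ _ _ fun i _ => hsmall i _ ?_
      have h1 := lt_valuation_of_not_close (hNc i i.2 j hj) (hφa j i) (hφb j i)
      have h2 := lt_valuation_of_not_close (fun h => hNc p p.2 j hj h.symm) (hψa p j) (hψb p j)
      rw [valuation_mul]
      refine lt_of_eq_of_lt ?_ (EReal.add_lt_add h2 h1)
      norm_cast
      ring
    · rw [valuation_neg]
      exact lt_valuation_sum _ _ _ fun i _ => hsmall i _ (hκ p i)
  rw [valuation_of_ne_zero hp] at hlt
  exact lt_irrefl _ hlt

end Hall

/-! ### Combining partial matchings -/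

section Matching

variable {Γ : AddSubgroup ℝ}

/-- The Mendelsohn–Dulmage theorem: if in a bipartite graph `E` some sets of vertices on both sides
can be matched, then there is a matching which covers both of them. -/
theorem exists_matching_covering {I J : Type*} {E : I → J → Prop} {p : I → Prop} {q : J → Prop}
    (f : {i // p i} → J) (hf : Function.Injective f) (hfE : ∀ i : {i // p i}, E i (f i))
    (g : {j // q j} → I) (hg : Function.Injective g) (hgE : ∀ j : {j // q j}, E (g j) j) :
    ∃ R : I → J → Prop, (∀ i j, R i j → E i j ∧ (p i ∨ q j)) ∧
      (∀ i j j', R i j → R i j' → j = j') ∧ (∀ i i' j, R i j → R i' j → i = i') ∧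
      (∀ i, p i → ∃ j, R i j) ∧ ∀ j, q j → ∃ i, R i j := by
  -- As in the Schröder–Bernstein theorem, a fixed point `A` of this map lets `f` be used on `A` and
  -- `g` on the vertices outside `f '' A` without conflict.
  let F : Set {i // p i} →o Set {i // p i} :=
    { toFun := fun A => {i | ∀ j : {j // q j}, (j : J) ∉ f '' A → g j ≠ i}
      monotone' := fun A B hAB i hi j hj => hi j fun h => hj (Set.image_mono hAB h) }
  let A := OrderHom.lfp F
  have hA : ∀ i, i ∈ A ↔ ∀ j : {j // q j}, (j : J) ∉ f '' A → g j ≠ i := by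
    intro i
    have : F A = A := OrderHom.map_lfp F
    conv_lhs => rw [← this]
    rfl
  refine ⟨fun i j => (∃ h : p i, (⟨i, h⟩ : {i // p i}) ∈ A ∧ f ⟨i, h⟩ = j) ∨
    ∃ h : q j, j ∉ f '' A ∧ g ⟨j, h⟩ = i, ?_, ?_, ?_, ?_, ?_⟩
  · rintro i j (⟨h, -, rfl⟩ | ⟨h, -, rfl⟩)
    · exact ⟨hfE ⟨i, h⟩, Or.inl h⟩
    · exact ⟨hgE ⟨j, h⟩, Or.inr h⟩
  · rintro i j j' (⟨h, hi, rfl⟩ | ⟨h, hj, h1⟩) (⟨h', hi', rfl⟩ | ⟨h', hj', h2⟩)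
    · rfl
    · exact absurd h2 ((hA _).1 hi ⟨j', h'⟩ hj')
    · exact absurd h1 ((hA _).1 hi' ⟨j, h⟩ hj)
    · exact congrArg Subtype.val (hg (h1.trans h2.symm))
  · rintro i i' j (⟨h, hi, h1⟩ | ⟨h, hj, h1⟩) (⟨h', hi', h2⟩ | ⟨h', hj', h2⟩)
    · exact congrArg Subtype.val (hf (h1.trans h2.symm))
    · exact absurd ⟨_, hi, h1⟩ hj'
    · exact absurd ⟨_, hi', h2⟩ hj
    · exact h1.symm.trans h2
  · intro i hi
    by_cases h : (⟨i, hi⟩ : {i // p i}) ∈ A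
    · exact ⟨_, Or.inl ⟨hi, h, rfl⟩⟩
    · rw [hA] at h
      push Not at h
      obtain ⟨j, hj, hgj⟩ := h
      exact ⟨j, Or.inr ⟨j.2, hj, hgj⟩⟩
  · intro j hj
    by_cases h : j ∈ f '' A
    · obtain ⟨i, hi, rfl⟩ := h
      exact ⟨i, Or.inl ⟨i.2, hi, rfl⟩⟩
    · exact ⟨_, Or.inr ⟨hj, h, rfl⟩⟩

theorem HasMatching.add {δ : ℝ≥0} {S T S' T' : Multiset (Bar Γ)} (h : HasMatching δ S T)
    (h' : HasMatching δ S' T') : HasMatching δ (S + S') (T + T') := by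
  obtain ⟨a, b, c, d, rfl, rfl, h1, h2, h3⟩ := h
  obtain ⟨a', b', c', d', rfl, rfl, h1', h2', h3'⟩ := h'
  refine ⟨a + a', b + b', c + c', d + d', by abel, by abel, ?_, ?_, h3.add h3'⟩
  · intro x hx
    exact (Multiset.mem_add.1 hx).elim (h1 x) (h1' x)
  · intro x hx
    exact (Multiset.mem_add.1 hx).elim (h2 x) (h2' x)

/-- Working with indices separates repeated bars, so that a partial bijection makes sense before
passing to multisets. -/
theorem hasMatching_of_rel {I J : Type*} (s : Finset I) (t : Finset J) (f : I → Bar Γ)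
    (g : J → Bar Γ) {δ : ℝ≥0} (R : I → J → Prop)
    (hR : ∀ i j, R i j → i ∈ s ∧ j ∈ t ∧ BarClose δ (f i) (g j))
    (hfun : ∀ i j j', R i j → R i j' → j = j') (hinj : ∀ i i' j, R i j → R i' j → i = i')
    (hs : ∀ i ∈ s, ¬ (f i).2 ≤ 2 * (δ : ℝ≥0∞) → ∃ j, R i j)
    (ht : ∀ j ∈ t, ¬ (g j).2 ≤ 2 * (δ : ℝ≥0∞) → ∃ i, R i j) :
    HasMatching δ (s.val.map f) (t.val.map g) := by
  classical
  set s1 := s.filter fun i => ∃ j, R i j with hs1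
  set t1 := t.filter fun j => ∃ i, R i j with ht1
  have hch : ∀ i : s1, ∃ j, R i j := fun i => (Finset.mem_filter.1 i.2).2
  choose h hh using hch
  have hhinj : Function.Injective h := by
    intro i i' hii
    exact Subtype.ext (hinj _ _ _ (hh i) (hii ▸ hh i'))
  have himg : t1 = s1.attach.image h := by
    ext j
    simp only [ht1, Finset.mem_filter, Finset.mem_image, Finset.mem_attach, true_and]
    constructor
    · rintro ⟨-, i, hi⟩
      have hi1 : i ∈ s1 := Finset.mem_filter.2 ⟨(hR _ _ hi).1, j, hi⟩
      exact ⟨⟨i, hi1⟩, hfun _ _ _ (hh ⟨i, hi1⟩) hi⟩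
    · rintro ⟨i, rfl⟩
      exact ⟨(hR _ _ (hh i)).2.1, i, hh i⟩
  refine ⟨(s.filter fun i => ¬ ∃ j, R i j).val.map f, s1.val.map f,
    (t.filter fun j => ¬ ∃ i, R i j).val.map g, t1.val.map g, ?_, ?_, ?_, ?_, ?_⟩
  · rw [← Multiset.map_add, add_comm, hs1, Finset.filter_val, Finset.filter_val,
      Multiset.filter_add_not]
  · rw [← Multiset.map_add, add_comm, ht1, Finset.filter_val, Finset.filter_val,
      Multiset.filter_add_not]
  · intro b hb
    obtain ⟨i, hi, rfl⟩ := Multiset.mem_map.1 hb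
    have := Finset.mem_filter.1 hi
    by_contra hlt
    exact this.2 (hs i this.1 hlt)
  · intro b hb
    obtain ⟨j, hj, rfl⟩ := Multiset.mem_map.1 hb
    have := Finset.mem_filter.1 hj
    by_contra hlt
    exact this.2 (ht j this.1 hlt)
  · rw [himg, Finset.image_val_of_injOn hhinj.injOn, Multiset.map_map]
    have : s1.val.map f = s1.attach.val.map fun i : s1 => f i := by
      exact (Multiset.attach_map_val' s1.val f).symm
    rw [this, Multiset.rel_map]
    exact Multiset.rel_refl_of_refl_on (r := fun i i' : s1 => BarClose δ (f i) (g (h i')))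
      fun i _ => (hR _ _ (hh i)).2.2

theorem IntervalClose.barClose {δ : ℝ≥0} {a b a' b' : ℝ} (h : IntervalClose Γ δ a b a' b')
    {L L' : ℝ≥0∞} (hL : (L = ⊤ ∧ L' = ⊤) ∨
      (L ≠ ⊤ ∧ L' ≠ ⊤ ∧ L.toReal = b - a ∧ L'.toReal = b' - a')) :
    BarClose δ ((a : ℝ ⧸ Γ), L) ((a' : ℝ ⧸ Γ), L') := by
  obtain ⟨g, h1, h2⟩ := h
  intro c hc ε hε
  have hc' := QuotientAddGroup.eq.1 hc
  obtain ⟨e, he⟩ : ∃ e : Γ, (e : ℝ) = -c + a := ⟨⟨_, hc'⟩, rfl⟩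
  -- Here `g` aligns the two intervals, and `e = a - c` accounts for the arbitrary representative
  -- `c` of the class of `a`.
  refine ⟨a' - g - e, ?_, ?_, ?_⟩
  · refine QuotientAddGroup.eq.2 ?_
    have : -(a' - (g : ℝ) - e) + a' = ((g + e : Γ) : ℝ) := by push_cast; ring
    rw [this]
    exact (g + e).2
  · have : a' - (g : ℝ) - e - c = a' - g - a := by rw [he]; ring
    rw [this]; linarith
  · refine hL.imp id fun ⟨h3, h4, h5, h6⟩ => ⟨h3, h4, ?_⟩
    dsimp only
    rw [h5, h6]
    have : a' - (g : ℝ) - e + (b' - a') - (c + (b - a)) = b' - g - b := by rw [he]; ring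
    rw [this]; linarith

end Matching

/-! ### Long bars inject into close bars -/

section Stability

variable {K : Type u} [Field K] {Γ : AddSubgroup ℝ}
variable {V : Type v} [AddCommGroup V] [Module (Novikov K Γ) V] {ℓ : V → EReal}
variable {W : Type v} [AddCommGroup W] [Module (Novikov K Γ) W] {ℓ' : W → EReal}

/-- Orthogonality bounds the level of each term by the level of the sum, which converts bounds on
levels into bounds on coefficients. -/
theorem le_valuation_repr {ι : Type*} [Fintype ι] {b : Module.Basis ι (Novikov K Γ) V}
    (hF : IsFiltration (K := K) (Γ := Γ) ℓ) (hb : IsOrthogonal (K := K) (Γ := Γ) ℓ b)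
    {x : V} {r : ℝ} (hx : ℓ x ≤ r) (i : ι) :
    (((ℓ (b i)).toReal - r : ℝ) : EReal) ≤ valuation (b.repr x i) := by
  have h := (isOrthogonal_iff hF).1 hb (b.repr x) i
  rw [b.sum_repr] at h
  by_cases h0 : b.repr x i = 0
  · rw [h0, valuation_zero]; exact le_top
  have h := h.trans hx
  rw [hF.smul_of_ne_zero h0, ← hF.coe_toReal (b.ne_zero i)] at h
  rw [valuation_of_ne_zero h0]
  norm_cast at h ⊢
  linarith

namespace SVD

variable {A : V →ₗ[Novikov K Γ] W} (s : SVD ℓ ℓ' A)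

theorem map_y_inr (i : Fin s.p) : A (s.y (Sum.inr i)) = 0 := by
  have : s.y (Sum.inr i) ∈ LinearMap.ker A := by
    rw [← s.span_ker]
    exact Submodule.subset_span ⟨i, rfl⟩
  exact this

theorem map_eq (z : V) : A z = ∑ i, s.y.repr z (Sum.inl i) • s.x (Sum.inl i) := by
  conv_lhs => rw [← s.y.sum_repr z, Fintype.sum_sum_type]
  simp only [map_add, map_sum, map_smul, s.map_y, s.map_y_inr, smul_zero, Finset.sum_const_zero,
    add_zero]

/-- This is what gives matrix entries a second bound: a coefficient of a boundary is also a
coefficient of a chain, and so is controlled by the right ends as well as the left ends. -/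
theorem repr_map_inl (z : V) (i : Fin s.r) :
    s.x.repr (A z) (Sum.inl i) = s.y.repr z (Sum.inl i) := by
  rw [s.map_eq]
  simp [Finsupp.single_apply]

theorem repr_map_inr (z : V) (i : Fin s.q) : s.x.repr (A z) (Sum.inr i) = 0 := by
  rw [s.map_eq]
  simp

end SVD

variable {V' : Type v} [AddCommGroup V'] [Module (Novikov K Γ) V'] {m : V' → EReal}
variable {W' : Type v} [AddCommGroup W'] [Module (Novikov K Γ) W'] {m' : W' → EReal}

/-- `φ` and `ψ` are the matrices of `Φ₀` and `Ψ₀` in the bases `x`. They are block triangular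
because chain maps preserve boundaries, so finite and infinite bars can be treated separately. -/
theorem SVD.exists_injective_close {A : V →ₗ[Novikov K Γ] W} {A' : V' →ₗ[Novikov K Γ] W'}
    (s : SVD ℓ ℓ' A) (t : SVD m m' A') (hℓ : IsFiltration (K := K) (Γ := Γ) ℓ)
    (hℓ' : IsFiltration (K := K) (Γ := Γ) ℓ') (hm : IsFiltration (K := K) (Γ := Γ) m)
    (hm' : IsFiltration (K := K) (Γ := Γ) m') {δ : ℝ} (Φ₁ : V →ₗ[Novikov K Γ] V')
    (Φ₀ : W →ₗ[Novikov K Γ] W') (Ψ₁ : V' →ₗ[Novikov K Γ] V) (Ψ₀ : W' →ₗ[Novikov K Γ] W)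
    (κ : W → V) (hΦ : ∀ z, A' (Φ₁ z) = Φ₀ (A z)) (hΨ : ∀ z, A (Ψ₁ z) = Ψ₀ (A' z))
    (hκ : ∀ z, Ψ₀ (Φ₀ z) = A (κ z) + z) (hΦ₁ : ∀ z, m (Φ₁ z) ≤ ℓ z + δ)
    (hΦ₀ : ∀ z, m' (Φ₀ z) ≤ ℓ' z + δ) (hΨ₁ : ∀ z, ℓ (Ψ₁ z) ≤ m z + δ)
    (hΨ₀ : ∀ z, ℓ' (Ψ₀ z) ≤ m' z + δ) (hκle : ∀ z, ℓ (κ z) ≤ ℓ' z + (2 * δ : ℝ)) :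
    (∃ f : {i : Fin s.r // 2 * δ <
        (ℓ (s.y (Sum.inl i))).toReal - (ℓ' (s.x (Sum.inl i))).toReal} → Fin t.r,
      Function.Injective f ∧ ∀ i : {i : Fin s.r // 2 * δ <
        (ℓ (s.y (Sum.inl i))).toReal - (ℓ' (s.x (Sum.inl i))).toReal}, IntervalClose Γ δ
        (ℓ' (s.x (Sum.inl i))).toReal (ℓ (s.y (Sum.inl i))).toReal
        (m' (t.x (Sum.inl (f i)))).toReal (m (t.y (Sum.inl (f i)))).toReal) ∧
    ∃ f : Fin s.q → Fin t.q, Function.Injective f ∧ ∀ i, IntervalClose Γ δ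
        (ℓ' (s.x (Sum.inr i))).toReal (ℓ' (s.x (Sum.inr i))).toReal
        (m' (t.x (Sum.inr (f i)))).toReal (m' (t.x (Sum.inr (f i)))).toReal := by
  have φle : ∀ j i, (((m' (t.x j)).toReal - (ℓ' (s.x i)).toReal - δ : ℝ) : EReal) ≤
      valuation (t.x.repr (Φ₀ (s.x i)) j) := by
    intro j i
    rw [sub_sub]
    refine le_valuation_repr hm' t.orthogonal_x ((hΦ₀ _).trans_eq ?_) j
    rw [← hℓ'.coe_toReal (s.x.ne_zero i)]
    rfl
  have ψle : ∀ i j, (((ℓ' (s.x i)).toReal - (m' (t.x j)).toReal - δ : ℝ) : EReal) ≤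
      valuation (s.x.repr (Ψ₀ (t.x j)) i) := by
    intro i j
    rw [sub_sub]
    refine le_valuation_repr hℓ' s.orthogonal_x ((hΨ₀ _).trans_eq ?_) i
    rw [← hm'.coe_toReal (t.x.ne_zero j)]
    rfl
  have hcomp : ∀ i' i, s.x.repr (A (κ (s.x i))) i' =
      ∑ j, s.x.repr (Ψ₀ (t.x j)) i' * t.x.repr (Φ₀ (s.x i)) j - s.x.repr (s.x i) i' := by
    intro i' i
    have h1 := hκ (s.x i)
    conv_lhs at h1 => rw [← t.x.sum_repr (Φ₀ (s.x i))]
    rw [eq_sub_iff_add_eq, ← Finsupp.add_apply, ← map_add, ← h1]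
    simp only [map_sum, map_smul, Finsupp.coe_finsetSum, Finset.sum_apply, Finsupp.smul_apply,
      smul_eq_mul]
    exact Finset.sum_congr rfl fun j _ => mul_comm _ _
  have hΦ0 : ∀ i j, t.x.repr (Φ₀ (s.x (Sum.inl i))) (Sum.inr j) = 0 := by
    intro i j
    rw [← s.map_y, ← hΦ, t.repr_map_inr]
  have hΨ0 : ∀ i j, s.x.repr (Ψ₀ (t.x (Sum.inl j))) (Sum.inr i) = 0 := by
    intro i j
    rw [← t.map_y, ← hΨ, s.repr_map_inr]
  constructor
  · refine Floer.exists_injective_close (K := K)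
      (a := fun i : {i : Fin s.r // 2 * δ <
        (ℓ (s.y (Sum.inl i))).toReal - (ℓ' (s.x (Sum.inl i))).toReal} =>
        (ℓ' (s.x (Sum.inl i))).toReal)
      (b := fun i => (ℓ (s.y (Sum.inl i))).toReal)
      (a' := fun j => (m' (t.x (Sum.inl j))).toReal)
      (b' := fun j => (m (t.y (Sum.inl j))).toReal)
      (φ := fun j i => t.x.repr (Φ₀ (s.x (Sum.inl i))) (Sum.inl j))
      (ψ := fun i j => s.x.repr (Ψ₀ (t.x (Sum.inl j))) (Sum.inl i))
      (fun j i => φle _ _) ?_ (fun i j => ψle _ _) ?_ ?_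
    · intro j i
      rw [← s.map_y, ← hΦ, t.repr_map_inl, sub_sub]
      refine le_valuation_repr hm t.orthogonal_y ((hΦ₁ _).trans_eq ?_) _
      rw [← hℓ.coe_toReal (s.y.ne_zero _)]
      rfl
    · intro i j
      rw [← t.map_y, ← hΨ, s.repr_map_inl, sub_sub]
      refine le_valuation_repr hℓ s.orthogonal_y ((hΨ₁ _).trans_eq ?_) _
      rw [← hm.coe_toReal (t.y.ne_zero _)]
      rfl
    · intro i' i
      have h := hcomp (Sum.inl i') (Sum.inl i)
      rw [Fintype.sum_sum_type] at h
      simp only [hΦ0, mul_zero, Finset.sum_const_zero, add_zero, s.repr_map_inl] at h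
      have h2 : s.x.repr (s.x (Sum.inl i)) (Sum.inl i') =
          (if i' = i then 1 else 0 : Novikov K Γ) := by
        simp [Finsupp.single_apply, Subtype.ext_iff, eq_comm]
      rw [h2] at h
      rw [← h]
      -- With `a`, `b` the ends of the bars, the homotopy gives valuation at least `b i' - a i -
      -- 2δ`. This exceeds the difference of midpoints exactly when the average length of the two
      -- bars exceeds `2δ`, which is why only long bars are indexed.
      refine lt_of_lt_of_le ?_ (le_valuation_repr hℓ s.orthogonal_y
        (r := (ℓ' (s.x (Sum.inl i))).toReal + 2 * δ) ((hκle _).trans_eq ?_) _)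
      · have h3 := i.2
        have h4 := i'.2
        rw [EReal.coe_lt_coe_iff]
        linarith
      · rw [← hℓ'.coe_toReal (s.x.ne_zero _)]
        rfl
  -- For infinite bars both ends are the same level, and the matrix of `ΨΦ - I` vanishes on this
  -- block, since the homotopy contributes only boundaries. No condition on lengths is needed.
  · refine Floer.exists_injective_close (K := K)
      (φ := fun j i => t.x.repr (Φ₀ (s.x (Sum.inr i))) (Sum.inr j))
      (ψ := fun i j => s.x.repr (Ψ₀ (t.x (Sum.inr j))) (Sum.inr i))
      (fun j i => φle _ _) (fun j i => φle _ _) (fun i j => ψle _ _) (fun i j => ψle _ _) ?_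
    intro i' i
    have h := hcomp (Sum.inr i') (Sum.inr i)
    rw [Fintype.sum_sum_type] at h
    simp only [hΨ0, zero_mul, Finset.sum_const_zero, zero_add, s.repr_map_inr] at h
    have h2 : s.x.repr (s.x (Sum.inr i)) (Sum.inr i') =
        (if i' = i then 1 else 0 : Novikov K Γ) := by
      simp [Finsupp.single_apply, eq_comm]
    rw [h2] at h
    rw [← h, valuation_zero]
    exact EReal.coe_lt_top _

end Stability

/-! ### From quasiequivalence to matchings: `d_B ≤ d_P` -/

section QuasiequivalentMatching

variable {K : Type u} [Field K] {Γ : AddSubgroup ℝ} {C D : FloerComplex.{u, v} K Γ}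

/-- The map on cycles induced by a chain map. -/
noncomputable def FloerComplex.cyclesMap (Φ : C.cx ⟶ D.cx) (k : ℤ) :
    C.cycles k →ₗ[Novikov K Γ] D.cycles k :=
  (Φ.f k).hom.restrict fun z hz => by
    have h := congrArg (fun f => f.hom z) (Φ.comm k (k - 1))
    have hz' : (C.cx.d k (k - 1)).hom z = 0 := hz
    simp only [ModuleCat.hom_comp, LinearMap.comp_apply, hz', map_zero] at h
    exact h

theorem FloerComplex.boundary_map (Φ : C.cx ⟶ D.cx) (k : ℤ) (z : C.cx.X (k + 1)) :
    D.boundary k ((Φ.f (k + 1)).hom z) = cyclesMap Φ k (C.boundary k z) :=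
  Subtype.ext (congrArg (fun f => f.hom z) (Φ.comm (k + 1) k))

theorem FloerComplex.cyclesMap_homotopy {Φ : C.cx ⟶ D.cx} {Ψ : D.cx ⟶ C.cx}
    (h : Homotopy (Φ ≫ Ψ) (𝟙 C.cx)) (k : ℤ) (z : C.cycles k) :
    cyclesMap Ψ k (cyclesMap Φ k z) = C.boundary k ((h.hom k (k + 1)).hom z) + z := by
  apply Subtype.ext
  have h1 := congrArg (fun f => f.hom (z : C.cx.X k)) (h.comm k)
  rw [dNext_eq h.hom (show (ComplexShape.down ℤ).Rel k (k - 1) by simp),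
    prevD_eq h.hom (show (ComplexShape.down ℤ).Rel (k + 1) k by simp)] at h1
  have hz : (C.cx.d k (k - 1)).hom z = 0 := z.2
  simp only [HomologicalComplex.comp_f, ModuleCat.hom_comp, ModuleCat.hom_add, LinearMap.comp_apply,
    LinearMap.add_apply, hz, map_zero, zero_add, HomologicalComplex.id_f, ModuleCat.hom_id,
    LinearMap.id_apply] at h1
  exact h1

theorem FloerComplex.exists_injective_close {Φ : C.cx ⟶ D.cx} {Ψ : D.cx ⟶ C.cx} {δ : ℝ}
    (h : Homotopy (Φ ≫ Ψ) (𝟙 C.cx))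
    (hΦ : ∀ (k : ℤ) (c : C.cx.X k), D.ℓ k ((Φ.f k).hom c) ≤ C.ℓ k c + (δ : EReal))
    (hΨ : ∀ (k : ℤ) (d : D.cx.X k), C.ℓ k ((Ψ.f k).hom d) ≤ D.ℓ k d + (δ : EReal))
    (hκ : ∀ (k : ℤ) (c : C.cx.X k),
      C.ℓ (k + 1) ((h.hom k (k + 1)).hom c) ≤ C.ℓ k c + ((2 * δ : ℝ) : EReal))
    {k : ℤ} (s : C.BoundarySVD k) (t : D.BoundarySVD k) :
    (∃ f : {i : Fin s.r // 2 * δ < (C.ℓ (k + 1) (s.y (Sum.inl i))).toReal -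
        (C.ℓ k (s.x (Sum.inl i))).toReal} → Fin t.r,
      Function.Injective f ∧ ∀ i : {i : Fin s.r // 2 * δ <
        (C.ℓ (k + 1) (s.y (Sum.inl i))).toReal - (C.ℓ k (s.x (Sum.inl i))).toReal},
        IntervalClose Γ δ
        (C.ℓ k (s.x (Sum.inl i))).toReal (C.ℓ (k + 1) (s.y (Sum.inl i))).toReal
        (D.ℓ k (t.x (Sum.inl (f i)))).toReal (D.ℓ (k + 1) (t.y (Sum.inl (f i)))).toReal) ∧
    ∃ f : Fin s.q → Fin t.q, Function.Injective f ∧ ∀ i, IntervalClose Γ δ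
        (C.ℓ k (s.x (Sum.inr i))).toReal (C.ℓ k (s.x (Sum.inr i))).toReal
        (D.ℓ k (t.x (Sum.inr (f i)))).toReal (D.ℓ k (t.x (Sum.inr (f i)))).toReal :=
  s.exists_injective_close t (C.orthogonalizable (k + 1)).isFiltration
    ((C.orthogonalizable k).isFiltration.restrict _)
    (D.orthogonalizable (k + 1)).isFiltration
    ((D.orthogonalizable k).isFiltration.restrict _)
    (Φ.f (k + 1)).hom (cyclesMap Φ k) (Ψ.f (k + 1)).hom (cyclesMap Ψ k)
    (fun z => (h.hom k (k + 1)).hom z) (boundary_map Φ k) (boundary_map Ψ k)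
    (cyclesMap_homotopy h k) (hΦ _) (fun z => hΦ k z) (hΨ _) (fun z => hΨ k z) (fun z => hκ k z)

/-- The levels of the cycles in a singular value decomposition. -/
noncomputable def FloerComplex.levelX {k : ℤ} (s : C.BoundarySVD k) (i : Fin s.r ⊕ Fin s.q) : ℝ :=
  (C.ℓ k (s.x i)).toReal

/-- The levels of the chains with nonzero boundary in a singular value decomposition. -/
noncomputable def FloerComplex.levelY {k : ℤ} (s : C.BoundarySVD k) (i : Fin s.r) : ℝ :=
  (C.ℓ (k + 1) (s.y (Sum.inl i))).toReal

theorem FloerComplex.coe_levelX {k : ℤ} (s : C.BoundarySVD k) (i : Fin s.r ⊕ Fin s.q) :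
    (levelX s i : EReal) = C.ℓ k (s.x i) :=
  (C.orthogonalizable k).isFiltration.coe_toReal fun h => s.x.ne_zero i (Subtype.ext h)

theorem FloerComplex.coe_levelY {k : ℤ} (s : C.BoundarySVD k) (i : Fin s.r) :
    (levelY s i : EReal) = C.ℓ (k + 1) (s.y (Sum.inl i)) :=
  (C.orthogonalizable (k + 1)).isFiltration.coe_toReal (s.y.ne_zero _)

theorem FloerComplex.levelX_le_levelY {k : ℤ} (s : C.BoundarySVD k) (i : Fin s.r) :
    levelX s (Sum.inl i) ≤ levelY s i := by
  have h := C.d_le k (s.y (Sum.inl i))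
  have h2 : (C.cx.d (k + 1) k).hom (s.y (Sum.inl i)) = s.x (Sum.inl i) :=
    congrArg Subtype.val (s.map_y i)
  rw [h2, ← coe_levelX, ← coe_levelY] at h
  exact EReal.coe_le_coe_iff.1 h

variable (Γ) in
/-- The barcode of the intervals `[a i, b i)` and `[c j, ∞)`, empty intervals being discarded. -/
noncomputable def barcodeOfLevels {I J : Type} [Fintype I] [Fintype J] (a b : I → ℝ) (c : J → ℝ) :
    Multiset (Bar Γ) :=
  open scoped Classical in
  ((Finset.univ : Finset I).filter fun i => a i < b i).val.map
      (fun i => ((a i : ℝ ⧸ Γ), ENNReal.ofReal (b i - a i))) +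
    (Finset.univ : Finset J).val.map (fun j => ((c j : ℝ ⧸ Γ), (⊤ : ℝ≥0∞)))

theorem verboseBarcode_eq {k : ℤ} (s : C.BoundarySVD k) :
    verboseBarcode s = (Finset.univ : Finset (Fin s.r)).val.map
      (fun i => ((FloerComplex.levelX s (Sum.inl i) : ℝ ⧸ Γ),
        ENNReal.ofReal (FloerComplex.levelY s i - FloerComplex.levelX s (Sum.inl i)))) +
      (Finset.univ : Finset (Fin s.q)).val.map
        (fun j => ((FloerComplex.levelX s (Sum.inr j) : ℝ ⧸ Γ), (⊤ : ℝ≥0∞))) := by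
  rw [verboseBarcode]
  congr 1
  refine Multiset.map_congr rfl fun i _ => ?_
  rw [← FloerComplex.coe_levelX, ← FloerComplex.coe_levelY, ← EReal.coe_sub,
    EReal.toENNReal_of_ne_top (EReal.coe_ne_top _), EReal.toReal_coe, EReal.toReal_coe]

theorem conciseBarcode_eq {k : ℤ} (s : C.BoundarySVD k) :
    conciseBarcode s = barcodeOfLevels Γ (fun i => FloerComplex.levelX s (Sum.inl i))
      (FloerComplex.levelY s) (fun j => FloerComplex.levelX s (Sum.inr j)) := by
  classical
  rw [conciseBarcode, verboseBarcode_eq, Multiset.filter_add, barcodeOfLevels]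
  congr 1
  · rw [Multiset.filter_map, Finset.filter_val]
    congr 1
    refine Multiset.filter_congr fun i _ => ?_
    simp only [Function.comp_apply, ENNReal.ofReal_pos, sub_pos]
  · rw [Multiset.filter_eq_self]
    intro b hb
    obtain ⟨j, -, rfl⟩ := Multiset.mem_map.1 hb
    exact ENNReal.zero_lt_top

theorem hasMatching_barcodeOfLevels {I J I' J' : Type} [Fintype I] [Fintype J] [Fintype I']
    [Fintype J'] {δ : ℝ≥0} {a b : I → ℝ} {c : J → ℝ} {a' b' : I' → ℝ} {c' : J' → ℝ}
    (hab : ∀ i, a i ≤ b i) (hab' : ∀ i, a' i ≤ b' i)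
    (f : {i // 2 * (δ : ℝ) < b i - a i} → I') (hf : Function.Injective f)
    (hfc : ∀ i : {i // 2 * (δ : ℝ) < b i - a i},
      IntervalClose Γ δ (a i) (b i) (a' (f i)) (b' (f i)))
    (g : {i // 2 * (δ : ℝ) < b' i - a' i} → I) (hg : Function.Injective g)
    (hgc : ∀ i : {i // 2 * (δ : ℝ) < b' i - a' i},
      IntervalClose Γ δ (a' i) (b' i) (a (g i)) (b (g i)))
    (f' : J → J') (hf' : Function.Injective f')
    (hfc' : ∀ j, IntervalClose Γ δ (c j) (c j) (c' (f' j)) (c' (f' j)))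
    (g' : J' → J) (hg' : Function.Injective g')
    (hgc' : ∀ j, IntervalClose Γ δ (c' j) (c' j) (c (g' j)) (c (g' j))) :
    HasMatching δ (barcodeOfLevels Γ a b c) (barcodeOfLevels Γ a' b' c') := by
  have hδ : (0 : ℝ) ≤ δ := δ.2
  have long : ∀ L : ℝ, ¬ ENNReal.ofReal L ≤ 2 * (δ : ℝ≥0∞) → 2 * (δ : ℝ) < L := by
    intro L hL
    by_contra hlt
    refine hL ((ENNReal.ofReal_le_ofReal (not_lt.1 hlt)).trans ?_)
    rw [ENNReal.ofReal_mul (by norm_num), ENNReal.ofReal_coe_nnreal]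
    simp
  refine HasMatching.add ?_ ?_
  · obtain ⟨R, hR, hfun, hinj, hs, ht⟩ := exists_matching_covering
      (E := fun i j => IntervalClose Γ δ (a i) (b i) (a' j) (b' j))
      f hf hfc g hg fun j => (hgc j).symm
    refine hasMatching_of_rel _ _ _ _ R ?_ hfun hinj ?_ ?_
    · intro i j hij
      obtain ⟨hc, hl⟩ := hR i j hij
      have h1 := hab i
      have h2 := hab' j
      refine ⟨?_, ?_, hc.barClose (Or.inr ⟨ENNReal.ofReal_ne_top, ENNReal.ofReal_ne_top,
        ENNReal.toReal_ofReal (by linarith), ENNReal.toReal_ofReal (by linarith)⟩)⟩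
      · rw [Finset.mem_filter]
        refine ⟨Finset.mem_univ _, ?_⟩
        -- One of the two bars is longer than `2δ` and the ends differ by at most `δ` after a shift,
        -- so both have positive length and survive in the concise barcode.
        obtain ⟨g, hg1, hg2⟩ := hc
        rw [abs_le] at hg1 hg2
        rcases hl with hl | hl <;> linarith
      · rw [Finset.mem_filter]
        refine ⟨Finset.mem_univ _, ?_⟩
        obtain ⟨g, hg1, hg2⟩ := hc
        rw [abs_le] at hg1 hg2
        rcases hl with hl | hl <;> linarith
    · exact fun i _ hi => hs i (long _ hi)
    · exact fun j _ hj => ht j (long _ hj)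
  · obtain ⟨R, hR, hfun, hinj, hs, ht⟩ := exists_matching_covering
      (p := fun _ : J => True) (q := fun _ : J' => True)
      (E := fun i j => IntervalClose Γ δ (c i) (c i) (c' j) (c' j))
      (fun i => f' i) (fun i i' h => Subtype.ext (hf' h)) (fun i => hfc' i)
      (fun i => g' i) (fun i i' h => Subtype.ext (hg' h)) fun j => (hgc' j).symm
    exact hasMatching_of_rel _ _ _ _ R (fun i j hij => ⟨Finset.mem_univ _, Finset.mem_univ _,
      (hR i j hij).1.barClose (Or.inl ⟨rfl, rfl⟩)⟩) hfun hinj (fun i _ _ => hs i trivial)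
      fun j _ _ => ht j trivial

theorem Quasiequivalent.hasMatching {δ : ℝ≥0} (h : Quasiequivalent δ C D) {k : ℤ}
    (s : C.BoundarySVD k) (t : D.BoundarySVD k) :
    HasMatching δ (conciseBarcode s) (conciseBarcode t) := by
  obtain ⟨Φ, Ψ, hC, hD, hΦ, hΨ, hKC, hKD⟩ := h
  obtain ⟨⟨f, hf, hfc⟩, f', hf', hfc'⟩ :=
    FloerComplex.exists_injective_close hC hΦ hΨ hKC s t
  obtain ⟨⟨g, hg, hgc⟩, g', hg', hgc'⟩ :=
    FloerComplex.exists_injective_close hD hΨ hΦ hKD t s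
  rw [conciseBarcode_eq, conciseBarcode_eq]
  exact hasMatching_barcodeOfLevels (FloerComplex.levelX_le_levelY s)
    (FloerComplex.levelX_le_levelY t) f hf hfc g hg hgc f' hf' hfc' g' hg' hgc'

/-- The parameters `0` and `1` are never exceptional and lie at distance one, so the ends are
`δ`-quasiequivalent directly. -/
theorem gradedBottleneckDist_le_interpolatingDist (sC : ∀ k : ℤ, C.BoundarySVD k)
    (sD : ∀ k : ℤ, D.BoundarySVD k) :
    gradedBottleneckDist (fun k => conciseBarcode (sC k)) (fun k => conciseBarcode (sD k)) ≤
      interpolatingDist C D := by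
  refine le_iInf₂ fun δ hδ => iSup_le fun k => ?_
  obtain ⟨S, F, hS, rfl, rfl, hF⟩ := hδ
  have h0 : (0 : ℝ) ∉ (S : Set ℝ) := fun h => (hS h).1.false
  have h1 : (1 : ℝ) ∉ (S : Set ℝ) := fun h => (hS h).2.false
  have h := hF 0 ⟨by simp, h0⟩ 1 ⟨by simp, h1⟩
  rw [zero_sub, abs_neg, abs_one, mul_one] at h
  exact iInf₂_le δ (h.hasMatching (sC k) (sD k))

end QuasiequivalentMatching

/-! ### Filtrations defined by levels on a basis -/

section BasisLevel

variable {K : Type u} [Field K] {Γ : AddSubgroup ℝ}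
variable {V : Type v} [AddCommGroup V] [Module (Novikov K Γ) V]
variable {W : Type v} [AddCommGroup W] [Module (Novikov K Γ) W] {ι : Type*}

/-- The filtration function for which a basis is orthogonal, with prescribed levels. -/
noncomputable def basisLevel (b : Module.Basis ι (Novikov K Γ) V) (lev : ι → ℝ) (z : V) : EReal :=
  ⨆ i, (lev i : EReal) - valuation (b.repr z i)

theorem le_basisLevel (b : Module.Basis ι (Novikov K Γ) V) (lev : ι → ℝ) (z : V) (i : ι) :
    (lev i : EReal) - valuation (b.repr z i) ≤ basisLevel b lev z :=
  le_iSup (fun i => (lev i : EReal) - valuation (b.repr z i)) i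

theorem basisLevel_smul_basis (b : Module.Basis ι (Novikov K Γ) V) (lev : ι → ℝ)
    (c : Novikov K Γ) (i : ι) : basisLevel b lev (c • b i) = lev i - valuation c := by
  apply le_antisymm
  · refine iSup_le fun j => ?_
    by_cases h : i = j
    · subst h; simp
    · simp [h]
  · refine le_of_eq_of_le ?_ (le_basisLevel b lev _ i)
    simp

theorem basisLevel_basis (b : Module.Basis ι (Novikov K Γ) V) (lev : ι → ℝ) (i : ι) :
    basisLevel b lev (b i) = lev i := by
  have := basisLevel_smul_basis b lev 1 i
  rwa [one_smul, valuation_one, sub_zero] at this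

theorem isFiltration_basisLevel [Finite ι] (b : Module.Basis ι (Novikov K Γ) V) (lev : ι → ℝ) :
    IsFiltration (K := K) (Γ := Γ) (basisLevel b lev) where
  ne_top z := by
    have := Fintype.ofFinite ι
    rw [basisLevel, ← Finset.sup_univ_eq_iSup, ← lt_top_iff_ne_top,
      Finset.sup_lt_iff bot_lt_top]
    intro i _
    by_cases h : b.repr z i = 0
    · rw [h, valuation_zero, EReal.sub_top]
      exact bot_lt_top
    · rw [valuation_of_ne_zero h, ← EReal.coe_sub]
      exact EReal.coe_lt_top _
  eq_bot_iff z := by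
    rw [basisLevel, iSup_eq_bot]
    constructor
    · intro h
      refine b.ext_elem fun i => ?_
      by_contra h0
      rw [map_zero, Finsupp.zero_apply] at h0
      have := h i
      rw [valuation_of_ne_zero h0, ← EReal.coe_sub] at this
      exact EReal.coe_ne_bot _ this
    · rintro rfl i
      simp
  smul c z := by
    by_cases hc : c = 0
    · subst hc
      rw [zero_smul, valuation_zero, EReal.sub_top, basisLevel, iSup_eq_bot]
      simp
    have h : ∀ i, (lev i : EReal) - valuation (b.repr (c • z) i) =
        (lev i : EReal) - valuation (b.repr z i) - valuation c := by
      intro i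
      rw [map_smul, Finsupp.smul_apply, smul_eq_mul, valuation_mul, valuation_of_ne_zero hc,
        add_comm, sub_eq_add_neg, EReal.neg_add (Or.inr (EReal.coe_ne_top _))
        (Or.inr (EReal.coe_ne_bot _)), sub_eq_add_neg, sub_eq_add_neg, sub_eq_add_neg, add_assoc]
    apply le_antisymm
    · refine iSup_le fun i => ?_
      rw [h]
      exact EReal.sub_le_sub (le_basisLevel b lev z i) le_rfl
    · refine EReal.sub_le_of_le_add (iSup_le fun i => ?_)
      refine le_trans ?_ (add_le_add_left (le_basisLevel b lev (c • z) i) _)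
      rw [h, valuation_of_ne_zero hc, EReal.sub_add_cancel]
  add_le x y := by
    refine iSup_le fun i => ?_
    rw [map_add, Finsupp.add_apply]
    have h := min_valuation_le_add (b.repr x i) (b.repr y i)
    rcases min_le_iff.1 h with h | h
    · exact le_max_of_le_left ((EReal.sub_le_sub le_rfl h).trans (le_basisLevel b lev x i))
    · exact le_max_of_le_right ((EReal.sub_le_sub le_rfl h).trans (le_basisLevel b lev y i))

theorem isOrthogonalizable_basisLevel [Finite ι] (b : Module.Basis ι (Novikov K Γ) V)
    (lev : ι → ℝ) : IsOrthogonalizable (K := K) (Γ := Γ) (basisLevel b lev) := by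
  have := Fintype.ofFinite ι
  have hF := isFiltration_basisLevel b lev
  refine ⟨hF, Fintype.card ι, b.reindex (Fintype.equivFin ι), ?_⟩
  have hb : IsOrthogonal (K := K) (Γ := Γ) (basisLevel b lev) b := by
    rw [isOrthogonal_iff hF]
    intro c i
    rw [basisLevel_smul_basis]
    refine le_of_eq_of_le ?_ (le_basisLevel b lev _ i)
    rw [b.repr_sum_self]
  have h := hb.reindex hF (Fintype.equivFin ι).symm
  rwa [← Module.Basis.coe_reindex] at h

/-- Filtration bounds need only be checked on the basis: the source level is the supremum over the
coordinates, and the target level is ultrametric. -/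
theorem basisLevel_map_le {ℓ : W → EReal} (hF : IsFiltration (K := K) (Γ := Γ) ℓ)
    (b : Module.Basis ι (Novikov K Γ) V) (lev : ι → ℝ) (A : V →ₗ[Novikov K Γ] W) (r : ℝ)
    (h : ∀ i, ℓ (A (b i)) ≤ ((lev i + r : ℝ) : EReal)) (z : V) :
    ℓ (A z) ≤ basisLevel b lev z + r := by
  have hz : A z = ∑ i ∈ (b.repr z).support, b.repr z i • A (b i) := by
    conv_lhs => rw [← b.linearCombination_repr z, Finsupp.linearCombination_apply, Finsupp.sum]
    simp only [map_sum, map_smul]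
  rw [hz]
  refine hF.sum_le _ _ fun i _ => ?_
  rw [hF.smul]
  refine (EReal.sub_le_sub (h i) le_rfl).trans
    (le_trans ?_ (add_le_add_left (le_basisLevel b lev z i) _))
  rw [EReal.coe_add, sub_eq_add_neg, sub_eq_add_neg, add_right_comm]

theorem IsOrthogonal.eq_basisLevel [Fintype ι] {ℓ : V → EReal}
    {b : Module.Basis ι (Novikov K Γ) V} (hb : IsOrthogonal (K := K) (Γ := Γ) ℓ b)
    (hF : IsFiltration (K := K) (Γ := Γ) ℓ) {lev : ι → ℝ} (h : ∀ i, ℓ (b i) = lev i) :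
    ℓ = basisLevel b lev := by
  funext z
  conv_lhs => rw [← b.sum_repr z]
  rw [hb, Finset.sup_univ_eq_iSup]
  simp only [hF.smul, h]
  rfl

end BasisLevel

/-! ### Maps and homotopies between complexes with bar bases -/

section BarModel

/-- The generators belonging to a graded family of bars: `x k f` in degree `k` and `y k f` in degree
`k + 1` for each bar `f` of degree `k`. -/
inductive Gen (Ω : ℤ → Type) : Type
  | x (k : ℤ) (f : Ω k) : Gen Ω
  | y (k : ℤ) (f : Ω k) : Gen Ω

/-- The degree of a generator. -/
def Gen.deg {Ω : ℤ → Type} : Gen Ω → ℤ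
  | .x k _ => k
  | .y k _ => k + 1

variable {K : Type u} [Field K] {Γ : AddSubgroup ℝ} {Ω : ℤ → Type}

/-- Orthogonal bases of the members of a Floer-type complex, indexed by the generators satisfying
`P`, of levels `lev`, on which the boundary operator takes each `y k f` to `x k f` and each `x k f`
to zero. A bar `f` is finite if both `x k f` and `y k f` are present, infinite if only `x k f` is,
and absent if neither is. -/
structure BarModel (C : FloerComplex.{u, v} K Γ) (P : Gen Ω → Prop) (lev : Gen Ω → ℝ) where
  basis : ∀ k : ℤ, Module.Basis {g : Gen Ω // P g ∧ g.deg = k} (Novikov K Γ) (C.cx.X k)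
  x_of_y : ∀ k f, P (.y k f) → P (.x k f)
  d_x : ∀ k i j f (h : P (.x k f)) (hk : (Gen.x k f).deg = i),
    (C.cx.d i j).hom (basis i ⟨.x k f, h, hk⟩) = 0
  d_y : ∀ k f (h : P (.y k f)) (hx : P (.x k f)) (hk : (Gen.y k f).deg = k + 1)
    (hk' : (Gen.x k f).deg = k),
    (C.cx.d (k + 1) k).hom (basis (k + 1) ⟨.y k f, h, hk⟩) = basis k ⟨.x k f, hx, hk'⟩
  ℓ_eq : ∀ k, C.ℓ k = basisLevel (basis k) fun i => lev i.1

namespace BarModel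

variable {C D : FloerComplex.{u, v} K Γ} {P P' : Gen Ω → Prop} {lev lev' : Gen Ω → ℝ}

theorem ℓ_basis (M : BarModel C P lev) {k : ℤ} (i : {g : Gen Ω // P g ∧ g.deg = k}) :
    C.ℓ k (M.basis k i) = lev i.1 := by
  rw [M.ℓ_eq, basisLevel_basis]

theorem map_le (M : BarModel C P lev) {k j : ℤ} (A : C.cx.X k →ₗ[Novikov K Γ] D.cx.X j) (r : ℝ)
    (h : ∀ i, D.ℓ j (A (M.basis k i)) ≤ ((lev i.1 + r : ℝ) : EReal)) (z : C.cx.X k) :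
    D.ℓ j (A z) ≤ C.ℓ k z + r := by
  rw [M.ℓ_eq]
  exact basisLevel_map_le (D.orthogonalizable j).isFiltration _ _ A r h z

open scoped Classical in
/-- The linear map matching the generators which are present in both models. -/
noncomputable def mapLin (M : BarModel C P lev) (M' : BarModel D P' lev') (k : ℤ) :
    C.cx.X k →ₗ[Novikov K Γ] D.cx.X k :=
  (M.basis k).constr (Novikov K Γ) fun g =>
    if h : P' g.1 then M'.basis k ⟨g.1, h, g.2.2⟩ else 0

theorem mapLin_of_pos (M : BarModel C P lev) (M' : BarModel D P' lev') {k : ℤ} {g : Gen Ω}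
    (h : P g) (hk : g.deg = k) (h' : P' g) :
    M.mapLin M' k (M.basis k ⟨g, h, hk⟩) = M'.basis k ⟨g, h', hk⟩ := by
  rw [mapLin, Module.Basis.constr_basis, dif_pos h']

theorem mapLin_of_neg (M : BarModel C P lev) (M' : BarModel D P' lev') {k : ℤ} {g : Gen Ω}
    (h : P g) (hk : g.deg = k) (h' : ¬ P' g) :
    M.mapLin M' k (M.basis k ⟨g, h, hk⟩) = 0 := by
  rw [mapLin, Module.Basis.constr_basis, dif_neg h']

theorem mapLin_le (M : BarModel C P lev) (M' : BarModel D P' lev') {δ : ℝ}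
    (hlev : ∀ g, |lev g - lev' g| ≤ δ) (k : ℤ) (z : C.cx.X k) :
    D.ℓ k (M.mapLin M' k z) ≤ C.ℓ k z + δ := by
  refine M.map_le _ _ (fun ⟨g, h, hk⟩ => ?_) z
  by_cases h' : P' g
  · rw [M.mapLin_of_pos M' h hk h', M'.ℓ_basis, EReal.coe_le_coe_iff]
    have := (abs_le.1 (hlev g)).1
    dsimp only
    linarith
  · rw [M.mapLin_of_neg M' h hk h', (D.orthogonalizable k).isFiltration.zero]
    exact bot_le

/-- The infinite bars of both sides agree, so a finite bar of `C` that has lost its `y` in `D` has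
lost its `x` too. Otherwise commutation would fail on `y`. -/
theorem mapLin_comm (M : BarModel C P lev) (M' : BarModel D P' lev')
    (hess : ∀ k f, (P (.x k f) ∧ ¬ P (.y k f)) ↔ (P' (.x k f) ∧ ¬ P' (.y k f))) (k : ℤ)
    (z : C.cx.X (k + 1)) : (D.cx.d (k + 1) k).hom (M.mapLin M' (k + 1) z) =
      M.mapLin M' k ((C.cx.d (k + 1) k).hom z) := by
  suffices h : (D.cx.d (k + 1) k).hom ∘ₗ M.mapLin M' (k + 1) =
      M.mapLin M' k ∘ₗ (C.cx.d (k + 1) k).hom from LinearMap.congr_fun h z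
  refine (M.basis (k + 1)).ext ?_
  rintro ⟨⟨j, f⟩ | ⟨j, f⟩, h, hk⟩
  · rw [LinearMap.comp_apply, LinearMap.comp_apply, M.d_x j (k + 1) k f h hk, map_zero]
    by_cases h' : P' (.x j f)
    · rw [M.mapLin_of_pos M' h hk h', M'.d_x j (k + 1) k f h' hk]
    · rw [M.mapLin_of_neg M' h hk h', map_zero]
  · obtain rfl : j = k := by
      have : j + 1 = k + 1 := hk
      omega
    have hx := M.x_of_y _ _ h
    have hk' : (Gen.x j f).deg = j := rfl
    rw [LinearMap.comp_apply, LinearMap.comp_apply, M.d_y j f h hx hk hk']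
    by_cases h' : P' (.y j f)
    · have hx' := M'.x_of_y _ _ h'
      rw [M.mapLin_of_pos M' h hk h', M'.d_y j f h' hx' hk hk', M.mapLin_of_pos M' hx hk' hx']
    · have h'' : ¬ P' (.x j f) := fun hx => ((hess j f).2 ⟨hx, h'⟩).2 h
      rw [M.mapLin_of_neg M' h hk h', M.mapLin_of_neg M' hx hk' h'', map_zero]

/-- The chain map matching the generators which are present in both models. -/
noncomputable def map (M : BarModel C P lev) (M' : BarModel D P' lev')
    (hess : ∀ k f, (P (.x k f) ∧ ¬ P (.y k f)) ↔ (P' (.x k f) ∧ ¬ P' (.y k f))) :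
    C.cx ⟶ D.cx where
  f k := ModuleCat.ofHom (M.mapLin M' k)
  comm' i j hij := by
    obtain rfl : j + 1 = i := hij
    ext z
    exact M.mapLin_comm M' hess j z

open scoped Classical in
/-- The contraction of the finite bars which are absent from the set `P'`. -/
noncomputable def homotopyLin (M : BarModel C P lev) (P' : Gen Ω → Prop) (i j : ℤ) :
    C.cx.X i →ₗ[Novikov K Γ] C.cx.X j :=
  (M.basis i).constr (Novikov K Γ) fun
    | ⟨.x k f, _⟩ => if h : (P (.y k f) ∧ ¬ P' (.x k f)) ∧ (Gen.y k f).deg = j then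
        -M.basis j ⟨.y k f, h.1.1, h.2⟩ else 0
    | ⟨.y _ _, _⟩ => 0

theorem homotopyLin_of_pos (M : BarModel C P lev) {k i j : ℤ} {f : Ω k} (hx : P (.x k f))
    (hk : (Gen.x k f).deg = i) (hy : P (.y k f)) (hj : (Gen.y k f).deg = j)
    (h' : ¬ P' (.x k f)) :
    M.homotopyLin P' i j (M.basis i ⟨.x k f, hx, hk⟩) = -M.basis j ⟨.y k f, hy, hj⟩ := by
  rw [homotopyLin, Module.Basis.constr_basis]
  exact dif_pos ⟨⟨hy, h'⟩, hj⟩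

theorem homotopyLin_of_neg (M : BarModel C P lev) {k i j : ℤ} {f : Ω k} (hx : P (.x k f))
    (hk : (Gen.x k f).deg = i) (h' : ¬ ((P (.y k f) ∧ ¬ P' (.x k f)) ∧ (Gen.y k f).deg = j)) :
    M.homotopyLin P' i j (M.basis i ⟨.x k f, hx, hk⟩) = 0 := by
  rw [homotopyLin, Module.Basis.constr_basis]
  exact dif_neg h'

theorem homotopyLin_y (M : BarModel C P lev) {k i j : ℤ} {f : Ω k} (hy : P (.y k f))
    (hk : (Gen.y k f).deg = i) : M.homotopyLin P' i j (M.basis i ⟨.y k f, hy, hk⟩) = 0 := by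
  rw [homotopyLin, Module.Basis.constr_basis]

theorem homotopyLin_eq_zero (M : BarModel C P lev) {i j : ℤ} (h : i + 1 ≠ j) :
    M.homotopyLin P' i j = 0 := by
  refine (M.basis i).ext ?_
  rintro ⟨⟨k, f⟩ | ⟨k, f⟩, hP, hk⟩
  · have hki : k = i := hk
    have hkj : ¬ (Gen.y k f).deg = j := hki ▸ h
    rw [M.homotopyLin_of_neg hP hk fun h' => hkj h'.2, LinearMap.zero_apply]
  · rw [M.homotopyLin_y hP hk, LinearMap.zero_apply]

/-- The composite is the identity on common generators and zero on those of absent bars, which are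
finite by `hess`. On such a bar the homotopy `x ↦ -y` gives `∂Kx = -x` and `K∂y = -y`. -/
theorem homotopyLin_comm (M : BarModel C P lev) (M' : BarModel D P' lev')
    (hess : ∀ k f, (P (.x k f) ∧ ¬ P (.y k f)) ↔ (P' (.x k f) ∧ ¬ P' (.y k f))) (k : ℤ)
    (z : C.cx.X (k + 1)) : M'.mapLin M (k + 1) (M.mapLin M' (k + 1) z) =
      M.homotopyLin P' k (k + 1) ((C.cx.d (k + 1) k).hom z) +
        (C.cx.d (k + 1 + 1) (k + 1)).hom (M.homotopyLin P' (k + 1) (k + 1 + 1) z) + z := by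
  suffices h : M'.mapLin M (k + 1) ∘ₗ M.mapLin M' (k + 1) =
      M.homotopyLin P' k (k + 1) ∘ₗ (C.cx.d (k + 1) k).hom +
        (C.cx.d (k + 1 + 1) (k + 1)).hom ∘ₗ M.homotopyLin P' (k + 1) (k + 1 + 1) +
          LinearMap.id from LinearMap.congr_fun h z
  refine (M.basis (k + 1)).ext ?_
  rintro ⟨⟨j, f⟩ | ⟨j, f⟩, h, hk⟩
  · have hj : (Gen.y j f).deg = k + 1 + 1 := congrArg (· + 1) hk
    have hjk : j = k + 1 := hk
    subst hjk
    simp only [LinearMap.add_apply, LinearMap.comp_apply, LinearMap.id_apply,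
      M.d_x (k + 1) (k + 1) k f h hk, map_zero, zero_add]
    by_cases h' : P' (.x (k + 1) f)
    · rw [M.mapLin_of_pos M' h hk h', M'.mapLin_of_pos M h' hk h,
        M.homotopyLin_of_neg h hk fun h2 => h2.1.2 h', map_zero, zero_add]
    · have hy : P (.y (k + 1) f) := by
        by_contra hy
        exact h' ((hess _ f).1 ⟨h, hy⟩).1
      rw [M.mapLin_of_neg M' h hk h', M.homotopyLin_of_pos h hk hy hj h', map_zero, map_neg,
        M.d_y (k + 1) f hy h hj hk, neg_add_cancel]
  · obtain rfl : j = k := by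
      have : j + 1 = k + 1 := hk
      omega
    have hx := M.x_of_y _ _ h
    have hk' : (Gen.x j f).deg = j := rfl
    simp only [LinearMap.add_apply, LinearMap.comp_apply, LinearMap.id_apply,
      M.d_y j f h hx hk hk', M.homotopyLin_y h hk, map_zero, add_zero]
    by_cases h' : P' (.y j f)
    · rw [M.mapLin_of_pos M' h hk h', M'.mapLin_of_pos M h' hk h,
        M.homotopyLin_of_neg hx hk' fun h2 => h2.1.2 (M'.x_of_y _ _ h'), zero_add]
    · have h'' : ¬ P' (.x j f) := fun hx => ((hess j f).2 ⟨hx, h'⟩).2 h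
      rw [M.mapLin_of_neg M' h hk h', M.homotopyLin_of_pos hx hk' h hk h'', map_zero,
        neg_add_cancel]

/-- The contraction as a chain homotopy. -/
noncomputable def homotopy (M : BarModel C P lev) (M' : BarModel D P' lev')
    (hess : ∀ k f, (P (.x k f) ∧ ¬ P (.y k f)) ↔ (P' (.x k f) ∧ ¬ P' (.y k f))) :
    Homotopy (M.map M' hess ≫ M'.map M fun k f => (hess k f).symm) (𝟙 C.cx) where
  hom i j := ModuleCat.ofHom (M.homotopyLin P' i j)
  zero i j hij := by
    rw [M.homotopyLin_eq_zero (fun h => hij h)]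
    rfl
  comm i := by
    obtain ⟨k, rfl⟩ : ∃ k, i = k + 1 := ⟨i - 1, by omega⟩
    rw [dNext_eq _ (show (ComplexShape.down ℤ).Rel (k + 1) k by simp),
      prevD_eq _ (show (ComplexShape.down ℤ).Rel (k + 1 + 1) (k + 1) by simp)]
    ext z
    exact M.homotopyLin_comm M' hess k z

/-- The contracted bar has length zero for `lev'`, and each of its ends moves by at most `δ`, so its
length for `lev` is at most `2δ`. -/
theorem homotopyLin_le (M : BarModel C P lev) {δ : ℝ}
    (hlev : ∀ g, |lev g - lev' g| ≤ δ)
    (hzero : ∀ k f, ¬ P' (.x k f) → lev' (.y k f) = lev' (.x k f)) (k : ℤ) (z : C.cx.X k) :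
    C.ℓ (k + 1) (M.homotopyLin P' k (k + 1) z) ≤ C.ℓ k z + ((2 * δ : ℝ) : EReal) := by
  have hF := (C.orthogonalizable (k + 1)).isFiltration
  refine M.map_le _ _ (fun ⟨g, h, hk⟩ => ?_) z
  rcases g with ⟨j, f⟩ | ⟨j, f⟩
  · by_cases h' : P (.y j f) ∧ ¬ P' (.x j f)
    · have hj : (Gen.y j f).deg = k + 1 := congrArg (· + 1) hk
      rw [M.homotopyLin_of_pos h hk h'.1 hj h'.2, hF.neg, M.ℓ_basis, EReal.coe_le_coe_iff]
      have h1 := abs_le.1 (hlev (.x j f))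
      have h2 := abs_le.1 (hlev (.y j f))
      have h3 := hzero j f h'.2
      dsimp only
      linarith
    · rw [M.homotopyLin_of_neg h hk fun h2 => h' h2.1, hF.zero]
      exact bot_le
  · rw [M.homotopyLin_y h hk, hF.zero]
    exact bot_le

theorem quasiequivalent (M : BarModel C P lev) (M' : BarModel D P' lev') {δ : ℝ}
    (hess : ∀ k f, (P (.x k f) ∧ ¬ P (.y k f)) ↔ (P' (.x k f) ∧ ¬ P' (.y k f)))
    (hlev : ∀ g, |lev g - lev' g| ≤ δ)
    (hzero : ∀ k f, ¬ P (.x k f) → lev (.y k f) = lev (.x k f))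
    (hzero' : ∀ k f, ¬ P' (.x k f) → lev' (.y k f) = lev' (.x k f)) :
    Quasiequivalent δ C D := by
  have hlev' : ∀ g, |lev' g - lev g| ≤ δ := fun g => abs_sub_comm (lev g) (lev' g) ▸ hlev g
  exact ⟨M.map M' hess, M'.map M fun k f => (hess k f).symm, M.homotopy M' hess,
    M'.homotopy M fun k f => (hess k f).symm, M.mapLin_le M' hlev, M'.mapLin_le M hlev',
    M.homotopyLin_le hlev hzero', M'.homotopyLin_le hlev' hzero⟩

end BarModel

end BarModel

/-! ### Constructing a complex from bars -/

section ModelComplex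

variable {K : Type u} [Field K] {Γ : AddSubgroup ℝ} {Ω : ℤ → Type}

namespace ModelComplex

variable {P : Gen Ω → Prop} (hP : ∀ k f, P (.y k f) → P (.x k f))
  (X : ℤ → Type v) [∀ k, AddCommGroup (X k)] [∀ k, Module (Novikov K Γ) (X k)]
  (b : ∀ k, Module.Basis {g : Gen Ω // P g ∧ g.deg = k} (Novikov K Γ) (X k))

/-- The boundary operator which takes each `y k f` to `x k f`. -/
noncomputable def dLin (i j : ℤ) : X i →ₗ[Novikov K Γ] X j :=
  (b i).constr (Novikov K Γ) fun
    | ⟨.x _ _, _⟩ => 0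
    | ⟨.y k f, h⟩ => if hj : (Gen.x k f).deg = j then b j ⟨.x k f, hP k f h.1, hj⟩ else 0

theorem dLin_x {i j k : ℤ} {f : Ω k} (h : P (.x k f)) (hk : (Gen.x k f).deg = i) :
    dLin hP X b i j (b i ⟨.x k f, h, hk⟩) = 0 := by
  rw [dLin, Module.Basis.constr_basis]

theorem dLin_y {i j k : ℤ} {f : Ω k} (h : P (.y k f)) (hk : (Gen.y k f).deg = i)
    (hj : (Gen.x k f).deg = j) :
    dLin hP X b i j (b i ⟨.y k f, h, hk⟩) = b j ⟨.x k f, hP k f h, hj⟩ := by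
  rw [dLin, Module.Basis.constr_basis]
  exact dif_pos hj

theorem dLin_y_of_ne {i j k : ℤ} {f : Ω k} (h : P (.y k f)) (hk : (Gen.y k f).deg = i)
    (hj : (Gen.x k f).deg ≠ j) : dLin hP X b i j (b i ⟨.y k f, h, hk⟩) = 0 := by
  rw [dLin, Module.Basis.constr_basis]
  exact dif_neg hj

theorem dLin_eq_zero {i j : ℤ} (h : j + 1 ≠ i) : dLin hP X b i j = 0 := by
  refine (b i).ext ?_
  rintro ⟨⟨k, f⟩ | ⟨k, f⟩, hg, hk⟩
  · rw [dLin_x hP X b hg hk, LinearMap.zero_apply]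
  · have hki : k + 1 = i := hk
    have hj : (Gen.x k f).deg ≠ j := by
      intro hj
      have hj' : k = j := hj
      omega
    rw [dLin_y_of_ne hP X b hg hk hj, LinearMap.zero_apply]

theorem dLin_dLin (i j k : ℤ) (z : X i) : dLin hP X b j k (dLin hP X b i j z) = 0 := by
  suffices h : dLin hP X b j k ∘ₗ dLin hP X b i j = 0 from LinearMap.congr_fun h z
  refine (b i).ext ?_
  rintro ⟨⟨l, f⟩ | ⟨l, f⟩, hg, hl⟩
  · rw [LinearMap.comp_apply, dLin_x hP X b hg hl, map_zero, LinearMap.zero_apply]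
  · rw [LinearMap.comp_apply, LinearMap.zero_apply]
    by_cases hj : (Gen.x l f).deg = j
    · rw [dLin_y hP X b hg hl hj, dLin_x hP X b (hP l f hg) hj]
    · rw [dLin_y_of_ne hP X b hg hl hj, map_zero]

/-- The chain complex with given bases and given pairing of the basis vectors. -/
noncomputable def chainComplex : ChainComplex (ModuleCat.{v} (Novikov K Γ)) ℤ where
  X k := ModuleCat.of _ (X k)
  d i j := ModuleCat.ofHom (dLin hP X b i j)
  shape i j h := by
    rw [dLin_eq_zero hP X b (fun h' => h h')]
    rfl
  d_comp_d' i j k _ _ := by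
    ext z
    exact dLin_dLin hP X b i j k z

variable [hfin : ∀ k, Finite {g : Gen Ω // P g ∧ g.deg = k}] {lev : Gen Ω → ℝ}
  (hlev : ∀ k f, P (.y k f) → lev (.x k f) ≤ lev (.y k f))

/-- The Floer-type complex with given orthogonal bases, levels and pairing of the basis vectors. -/
noncomputable def floerComplex : FloerComplex.{u, v} K Γ where
  cx := chainComplex hP X b
  ℓ k := basisLevel (b k) fun i => lev i.1
  orthogonalizable k := isOrthogonalizable_basisLevel (b k) _
  d_le k z := by
    have hF := isFiltration_basisLevel (b k) fun i => lev i.1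
    refine (basisLevel_map_le hF (b (k + 1)) (fun i => lev i.1) (dLin hP X b (k + 1) k) 0 ?_
      z).trans_eq (add_zero _)
    rintro ⟨⟨l, f⟩ | ⟨l, f⟩, hg, hl⟩
    · rw [dLin_x hP X b hg hl, hF.zero]
      exact bot_le
    · by_cases hj : (Gen.x l f).deg = k
      · rw [dLin_y hP X b hg hl hj, basisLevel_basis, add_zero]
        exact EReal.coe_le_coe_iff.2 (hlev l f hg)
      · rw [dLin_y_of_ne hP X b hg hl hj, hF.zero]
        exact bot_le

/-- The defining bases of the complex. -/
noncomputable def barModel : BarModel (floerComplex hP X b hlev) P lev where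
  basis := b
  x_of_y := hP
  d_x _ _ _ _ h hk := dLin_x hP X b h hk
  d_y _ _ h _ hk hk' := dLin_y hP X b h hk hk'
  ℓ_eq _ := rfl

end ModelComplex

end ModelComplex

/-! ### Singular value decompositions as bar bases -/

section ModelOfSVD

variable {K : Type u} [Field K] {Γ : AddSubgroup ℝ} {C : FloerComplex.{u, v} K Γ}

/-- Replacing one part of an orthogonal basis by another orthogonal basis of its span. -/
theorem exists_orthogonal_basis_sum {V : Type v} [AddCommGroup V] [Module (Novikov K Γ) V]
    {ℓ : V → EReal} (hF : IsFiltration (K := K) (Γ := Γ) ℓ) {ι κ θ : Type} [Fintype ι] [Fintype κ]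
    [Fintype θ] (y : Module.Basis (ι ⊕ κ) (Novikov K Γ) V)
    (hyo : IsOrthogonal (K := K) (Γ := Γ) ℓ y) {U : Submodule (Novikov K Γ) V}
    (hU : Submodule.span (Novikov K Γ) (Set.range fun j => y (Sum.inr j)) = U)
    (x : Module.Basis θ (Novikov K Γ) U)
    (hxo : IsOrthogonal (K := K) (Γ := Γ) (fun z : U => ℓ z) x) :
    ∃ b : Module.Basis (ι ⊕ θ) (Novikov K Γ) V, IsOrthogonal (K := K) (Γ := Γ) ℓ b ∧
      (∀ i, b (Sum.inl i) = y (Sum.inl i)) ∧ ∀ i, b (Sum.inr i) = x i := by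
  let w : ι ⊕ θ → V := Sum.elim (fun i => y (Sum.inl i)) fun i => x i
  have hy := (isOrthogonal_iff hF).1 hyo
  have hx := (isOrthogonal_iff (hF.restrict U)).1 hxo
  have hw0 : ∀ i, w i ≠ 0 := by
    rintro (i | i)
    · exact y.ne_zero _
    · exact fun h => x.ne_zero i (Subtype.ext h)
  have hw : IsOrthogonal (K := K) (Γ := Γ) ℓ w := by
    rw [isOrthogonal_iff hF]
    intro c
    rw [Fintype.sum_sum_type]
    obtain ⟨z, hz, hzle⟩ : ∃ z : U, ∑ i, c (Sum.inr i) • w (Sum.inr i) = (z : V) ∧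
        ∀ i, ℓ (c (Sum.inr i) • (x i : V)) ≤ ℓ z := by
      refine ⟨_, ?_, fun i => hx (fun i => c (Sum.inr i)) i⟩
      rw [Submodule.coe_sum]
      rfl
    rw [hz]
    obtain ⟨d, hd⟩ := (Submodule.mem_span_range_iff_exists_fun _).1 (hU.ge z.2)
    -- The vectors `y (Sum.inl i)` are orthogonal to all of `U`, so any orthogonal basis of `U` can
    -- complete them. The part in `U` is then bounded as the difference of the total and the first
    -- part.
    have hinl : ∀ i, ℓ (c (Sum.inl i) • y (Sum.inl i)) ≤
        ℓ (∑ i, c (Sum.inl i) • y (Sum.inl i) + z) := by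
      intro i
      have h := hy (Sum.elim (fun i => c (Sum.inl i)) d) (Sum.inl i)
      rw [Fintype.sum_sum_type] at h
      simp only [Sum.elim_inl, Sum.elim_inr] at h
      rwa [hd] at h
    rintro (i | i)
    · exact hinl i
    · refine (hzle i).trans ?_
      have h : (z : V) = (∑ i, c (Sum.inl i) • y (Sum.inl i) + z) -
          ∑ i, c (Sum.inl i) • y (Sum.inl i) := by abel
      conv_lhs => rw [h]
      exact (hF.sub_le _ _).trans (max_le le_rfl (hF.sum_le _ _ fun i _ => hinl i))
  have hspan : ⊤ ≤ Submodule.span (Novikov K Γ) (Set.range w) := by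
    intro v _
    rw [← y.sum_repr v, Fintype.sum_sum_type]
    refine Submodule.add_mem _ (Submodule.sum_mem _ fun i _ => Submodule.smul_mem _ _
      (Submodule.subset_span ⟨Sum.inl i, rfl⟩)) ?_
    have hzc : ∑ i, y.repr v (Sum.inr i) • y (Sum.inr i) ∈ U := by
      rw [← hU]
      exact Submodule.sum_mem _ fun i _ => Submodule.smul_mem _ _ (Submodule.subset_span ⟨i, rfl⟩)
    have h := congrArg Subtype.val (x.sum_repr ⟨_, hzc⟩)
    rw [Submodule.coe_sum] at h
    rw [← show _ = ∑ i, y.repr v (Sum.inr i) • y (Sum.inr i) from h]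
    exact Submodule.sum_mem _ fun i _ => Submodule.smul_mem _ _
      (Submodule.subset_span ⟨Sum.inr i, rfl⟩)
  refine ⟨Module.Basis.mk (hw.linearIndependent hF hw0) hspan, ?_, fun i => ?_, fun i => ?_⟩
  · rwa [Module.Basis.coe_mk]
  · rw [Module.Basis.mk_apply]; rfl
  · rw [Module.Basis.mk_apply]; rfl

/-- Singular value decompositions of two consecutive boundary operators give rise to an orthogonal
basis of the space of chains between them. -/
theorem FloerComplex.exists_basis {m : ℤ} (s : C.BoundarySVD m) (t : C.BoundarySVD (m + 1)) :
    ∃ b : Module.Basis (Fin s.r ⊕ (Fin t.r ⊕ Fin t.q)) (Novikov K Γ) (C.cx.X (m + 1)),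
      IsOrthogonal (K := K) (Γ := Γ) (C.ℓ (m + 1)) b ∧
      (∀ i, b (Sum.inl i) = s.y (Sum.inl i)) ∧ ∀ i, b (Sum.inr i) = t.x i := by
  -- The cycles of degree `m + 1` are defined with target degree `m + 1 - 1`, which has to be
  -- identified with `m`.
  have hker : LinearMap.ker (C.boundary m) = C.cycles (m + 1) := by
    have hd : ∀ j, j = m → LinearMap.ker (C.cx.d (m + 1) j).hom =
        LinearMap.ker (C.cx.d (m + 1) m).hom := by
      rintro j rfl; rfl
    exact (LinearMap.ker_codRestrict _ _ _).trans (hd (m + 1 - 1) (by omega)).symm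
  exact exists_orthogonal_basis_sum (C.orthogonalizable (m + 1)).isFiltration s.y s.orthogonal_y
    (s.span_ker.trans hker) t.x t.orthogonal_x

theorem exists_orthogonal_basis_smul {V : Type v} [AddCommGroup V] [Module (Novikov K Γ) V]
    {ℓ : V → EReal} (hF : IsFiltration (K := K) (Γ := Γ) ℓ) {ι κ : Type*} [Fintype ι]
    (w : Module.Basis ι (Novikov K Γ) V) (hw : IsOrthogonal (K := K) (Γ := Γ) ℓ w) (e : ι ≃ κ)
    (u : κ → Novikov K Γ) (hu : ∀ g, u g ≠ 0) :
    ∃ b : Module.Basis κ (Novikov K Γ) V, (∀ g, b g = u g • w (e.symm g)) ∧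
      ∀ lev : κ → ℝ, (∀ g, ℓ (b g) = lev g) → ℓ = basisLevel b lev := by
  let b := (w.reindex e).isUnitSMul fun g => (hu g).isUnit
  have hb : ∀ g, b g = u g • w (e.symm g) := fun g => by
    rw [Module.Basis.isUnitSMul_apply, Module.Basis.reindex_apply]
  refine ⟨b, hb, fun lev h => ?_⟩
  have : Fintype κ := Fintype.ofEquiv _ e
  have hort : IsOrthogonal (K := K) (Γ := Γ) ℓ b := by
    have h1 : (b : κ → V) = fun g => u g • (w ∘ e.symm) g := funext hb
    rw [h1]
    exact (hw.reindex hF e.symm).smul hF u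
  exact hort.eq_basisLevel hF h

/-- The generators of those bars which are labelled by the indices of singular value
decompositions. -/
def Labelled {Ω : ℤ → Type} {r q : ℤ → ℕ} (π : ∀ k, Ω k → Option (Fin (r k) ⊕ Fin (q k))) :
    Gen Ω → Prop
  | .x k f => ∃ i, π k f = some i
  | .y k f => ∃ i, π k f = some (Sum.inl i)

/-- Degree `m + 1` contains the left ends of bars of degree `m + 1` and the right ends of finite
bars of degree `m`, so its generators are indexed by two consecutive decompositions. -/
theorem exists_labelled_equiv {Ω : ℤ → Type} {r q : ℤ → ℕ}
    (π : ∀ k, Ω k → Option (Fin (r k) ⊕ Fin (q k))) (hπ : ∀ k i, ∃! f, π k f = some i) (m : ℤ) :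
    ∃ e : Fin (r m) ⊕ (Fin (r (m + 1)) ⊕ Fin (q (m + 1))) ≃
        {g : Gen Ω // Labelled π g ∧ g.deg = m + 1},
      (∀ f i (h : Labelled π (.x (m + 1) f)) (hk : (Gen.x (m + 1) f).deg = m + 1),
        π (m + 1) f = some i → e.symm ⟨.x (m + 1) f, h, hk⟩ = Sum.inr i) ∧
      ∀ f i (h : Labelled π (.y m f)) (hk : (Gen.y m f).deg = m + 1),
        π m f = some (Sum.inl i) → e.symm ⟨.y m f, h, hk⟩ = Sum.inl i := by
  choose F hFπ hFu using hπ
  let φ : Fin (r m) ⊕ (Fin (r (m + 1)) ⊕ Fin (q (m + 1))) →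
      {g : Gen Ω // Labelled π g ∧ g.deg = m + 1} :=
    Sum.elim (fun i => ⟨.y m (F m (Sum.inl i)), ⟨i, hFπ m (Sum.inl i)⟩, rfl⟩)
      fun i => ⟨.x (m + 1) (F (m + 1) i), ⟨i, hFπ (m + 1) i⟩, rfl⟩
  have hFinj : ∀ k, Function.Injective (F k) := by
    intro k i i' h
    have h1 := hFπ k i
    rw [h, hFπ k i'] at h1
    exact (Option.some_injective _ h1).symm
  have hφx : ∀ f i (h : Labelled π (.x (m + 1) f)) (hk : (Gen.x (m + 1) f).deg = m + 1),
      π (m + 1) f = some i → φ (Sum.inr i) = ⟨.x (m + 1) f, h, hk⟩ :=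
    fun f i h hk hi => Subtype.ext (congrArg (Gen.x (m + 1)) (hFu _ _ _ hi).symm)
  have hφy : ∀ f i (h : Labelled π (.y m f)) (hk : (Gen.y m f).deg = m + 1),
      π m f = some (Sum.inl i) → φ (Sum.inl i) = ⟨.y m f, h, hk⟩ :=
    fun f i h hk hi => Subtype.ext (congrArg (Gen.y m) (hFu _ _ _ hi).symm)
  have hφ : Function.Bijective φ := by
    constructor
    · rintro (i | i) (j | j) h
      · have h1 : Gen.y m (F m (Sum.inl i)) = Gen.y m (F m (Sum.inl j)) := congrArg Subtype.val h
        exact congrArg _ (Sum.inl_injective (hFinj m (eq_of_heq (Gen.y.inj h1).2)))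
      · exact absurd (congrArg Subtype.val h) (by simp [φ])
      · exact absurd (congrArg Subtype.val h) (by simp [φ])
      · have h1 : Gen.x (m + 1) (F (m + 1) i) = Gen.x (m + 1) (F (m + 1) j) :=
          congrArg Subtype.val h
        exact congrArg _ (hFinj (m + 1) (eq_of_heq (Gen.x.inj h1).2))
    · rintro ⟨⟨k, f⟩ | ⟨k, f⟩, ⟨i, hi⟩, hk⟩
      · have hk' : k = m + 1 := hk
        subst hk'
        exact ⟨Sum.inr i, hφx _ _ ⟨i, hi⟩ hk hi⟩
      · have hk' : k = m := by
          have : k + 1 = m + 1 := hk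
          omega
        subst hk'
        exact ⟨Sum.inl i, hφy _ _ ⟨i, hi⟩ hk hi⟩
  refine ⟨Equiv.ofBijective φ hφ, fun f i h hk hi => ?_, fun f i h hk hi => ?_⟩
  · rw [Equiv.symm_apply_eq]
    exact (hφx f i h hk hi).symm
  · rw [Equiv.symm_apply_eq]
    exact (hφy f i h hk hi).symm

variable {Ω : ℤ → Type} (s : ∀ k, C.BoundarySVD k)
  (π : ∀ k, Ω k → Option (Fin (s k).r ⊕ Fin (s k).q))

set_option maxHeartbeats 1000000 in
-- Multiplying by `T^γ` lowers a level by `γ`. The same monomial is used at both ends of a bar, so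
-- the boundary relation is kept. The transport along `hm` lets the statement hold for a variable
-- degree `k`, as needed to choose all the bases at once.
theorem FloerComplex.exists_labelled_basis (hπ : ∀ k i, ∃! f, π k f = some i)
    (γ : ∀ k, Ω k → Γ) {lev : Gen Ω → ℝ}
    (hx : ∀ k f i, π k f = some i → lev (.x k f) = levelX (s k) i - γ k f)
    (hy : ∀ k f i, π k f = some (Sum.inl i) → lev (.y k f) = levelY (s k) i - γ k f) (k : ℤ) :
    ∃ b : Module.Basis {g : Gen Ω // Labelled π g ∧ g.deg = k} (Novikov K Γ) (C.cx.X k),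
      (∀ (f : Ω k) i (h : Labelled π (.x k f)) (hk : (Gen.x k f).deg = k), π k f = some i →
        b ⟨.x k f, h, hk⟩ = monomial K (γ k f) • ((s k).x i : C.cx.X k)) ∧
      (∀ (m : ℤ) (f : Ω m) i (h : Labelled π (.y m f)) (hm : m + 1 = k),
        π m f = some (Sum.inl i) →
        b ⟨.y m f, h, hm⟩ = hm ▸ (monomial K (γ m f) • (s m).y (Sum.inl i))) ∧
      C.ℓ k = basisLevel b fun i => lev i.1 := by
  obtain ⟨m, rfl⟩ : ∃ m, k = m + 1 := ⟨k - 1, by omega⟩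
  have hF := (C.orthogonalizable (m + 1)).isFiltration
  obtain ⟨w, hw, hwl, hwr⟩ := FloerComplex.exists_basis (s m) (s (m + 1))
  obtain ⟨e, hex, hey⟩ := exists_labelled_equiv π hπ m
  let u : {g : Gen Ω // Labelled π g ∧ g.deg = m + 1} → Novikov K Γ := fun g =>
    match g.1 with
    | .x k f => monomial K (γ k f)
    | .y k f => monomial K (γ k f)
  have hu : ∀ g, u g ≠ 0 := by
    rintro ⟨⟨k, f⟩ | ⟨k, f⟩, h⟩ <;> exact monomial_ne_zero _
  obtain ⟨b, hb, hbl⟩ := exists_orthogonal_basis_smul hF w hw e u hu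
  have hbx : ∀ (f : Ω (m + 1)) i (h : Labelled π (.x (m + 1) f))
      (hk : (Gen.x (m + 1) f).deg = m + 1), π (m + 1) f = some i →
        b ⟨.x (m + 1) f, h, hk⟩ =
          monomial K (γ (m + 1) f) • ((s (m + 1)).x i : C.cx.X (m + 1)) := by
    intro f i h hk hi
    rw [hb, hex f i h hk hi, hwr]
  have hby : ∀ (f : Ω m) i (h : Labelled π (.y m f)) (hk : (Gen.y m f).deg = m + 1),
      π m f = some (Sum.inl i) →
        b ⟨.y m f, h, hk⟩ = monomial K (γ m f) • (s m).y (Sum.inl i) := by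
    intro f i h hk hi
    rw [hb, hey f i h hk hi, hwl]
  refine ⟨b, hbx, ?_, hbl _ ?_⟩
  · intro m' f i h hm hi
    obtain rfl : m' = m := by omega
    exact hby f i h hm hi
  · rintro ⟨⟨k, f⟩ | ⟨k, f⟩, ⟨i, hi⟩, hk⟩
    · have hk' : k = m + 1 := hk
      subst hk'
      rw [hbx f i ⟨i, hi⟩ hk hi, hF.smul, valuation_monomial, ← coe_levelX, ← EReal.coe_sub,
        hx _ _ _ hi]
    · have hk' : k = m := by
        have : k + 1 = m + 1 := hk
        omega
      subst hk'
      rw [hby f i ⟨i, hi⟩ hk hi, hF.smul, valuation_monomial, ← coe_levelY, ← EReal.coe_sub,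
        hy _ _ _ hi]

/-- Singular value decompositions in all degrees, rescaled by monomials, as a model of a complex. -/
theorem FloerComplex.nonempty_barModel (hπ : ∀ k i, ∃! f, π k f = some i)
    (γ : ∀ k, Ω k → Γ) {lev : Gen Ω → ℝ}
    (hx : ∀ k f i, π k f = some i → lev (.x k f) = levelX (s k) i - γ k f)
    (hy : ∀ k f i, π k f = some (Sum.inl i) → lev (.y k f) = levelY (s k) i - γ k f) :
    Nonempty (BarModel C (Labelled π) lev) := by
  choose b hbx hby hbl using FloerComplex.exists_labelled_basis s π hπ γ hx hy
  refine ⟨⟨b, ?_, ?_, ?_, hbl⟩⟩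
  · rintro k f ⟨i, hi⟩
    exact ⟨_, hi⟩
  · rintro k l j f ⟨i, hi⟩ hk
    have hk' : k = l := hk
    subst hk'
    rw [hbx k f i ⟨i, hi⟩ hk hi, map_smul]
    by_cases hj : j = k - 1
    · subst hj
      rw [show (C.cx.d k (k - 1)).hom ((s k).x i : C.cx.X k) = 0 from ((s k).x i).2, smul_zero]
    · rw [C.cx.shape k j fun h => hj (eq_sub_of_add_eq h)]
      simp
  · rintro k f ⟨i, hi⟩ hx' hk hk'
    rw [hbx k f (Sum.inl i) hx' hk' hi, hby (k + 1) k f i ⟨i, hi⟩ hk hi]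
    simp only [map_smul]
    congr 1
    exact congrArg Subtype.val ((s k).map_y i)

end ModelOfSVD

/-! ### Linear interpolation between bar bases -/

section Interpolation

variable {K : Type u} [Field K] {Γ : AddSubgroup ℝ} {Ω : ℤ → Type}
variable {C D : FloerComplex.{u, v} K Γ} {P P' : Gen Ω → Prop} {lev lev' : Gen Ω → ℝ}

theorem BarModel.lev_le (M : BarModel C P lev) (k : ℤ) (f : Ω k) (h : P (.y k f)) :
    lev (.x k f) ≤ lev (.y k f) := by
  have hk : (Gen.y k f).deg = k + 1 := rfl
  have hk' : (Gen.x k f).deg = k := rfl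
  have h1 := C.d_le k (M.basis (k + 1) ⟨.y k f, h, hk⟩)
  rw [M.d_y k f h (M.x_of_y k f h) hk hk', M.ℓ_basis, M.ℓ_basis] at h1
  exact EReal.coe_le_coe_iff.1 h1

theorem BarModel.finite (M : BarModel C P lev) (k : ℤ) :
    Finite {g : Gen Ω // P g ∧ g.deg = k} := by
  obtain ⟨n, b, -⟩ := (C.orthogonalizable k).exists_basis
  have : Module.Finite (Novikov K Γ) (C.cx.X k) := Module.Finite.of_basis b
  exact Module.Finite.finite_basis (M.basis k)

/-- A module with a basis indexed by part of the disjoint union of the index sets of two bases, in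
the universe of the modules they are bases of. -/
theorem exists_module_basis {V W : Type v} [AddCommGroup V] [Module (Novikov K Γ) V]
    [AddCommGroup W] [Module (Novikov K Γ) W] {I J ι : Type*}
    (b : Module.Basis I (Novikov K Γ) V) (b' : Module.Basis J (Novikov K Γ) W) (f : ι → I ⊕ J)
    (hf : Function.Injective f) : ∃ (X : Type v) (_ : AddCommGroup X) (_ : Module (Novikov K Γ) X),
      Nonempty (Module.Basis ι (Novikov K Γ) X) :=
  ⟨_, _, _, ⟨Module.Basis.span ((b.prod b').linearIndependent.comp f hf)⟩⟩

/-- Two families of bars, with absent bars of length zero, are interpolated by moving the endpoints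
of the bars linearly. -/
theorem BarModel.hasInterpolation (M : BarModel C P lev) (M' : BarModel D P' lev') {δ : ℝ≥0}
    (hess : ∀ k f, (P (.x k f) ∧ ¬ P (.y k f)) ↔ (P' (.x k f) ∧ ¬ P' (.y k f)))
    (hlev : ∀ g, |lev g - lev' g| ≤ δ)
    (hzero : ∀ k f, ¬ P (.x k f) → lev (.y k f) = lev (.x k f))
    (hzero' : ∀ k f, ¬ P' (.x k f) → lev' (.y k f) = lev' (.x k f)) :
    HasInterpolation δ C D := by
  classical
  -- In the interior every bar of either end is present; the two ends are recovered by deleting bars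
  -- whose length has become zero.
  let Q : Gen Ω → Prop := fun g => P g ∨ P' g
  let L : ℝ → Gen Ω → ℝ := fun s g => (1 - s) * lev g + s * lev' g
  have hQ : ∀ k f, Q (.y k f) → Q (.x k f) := fun k f =>
    Or.imp (M.x_of_y k f) (M'.x_of_y k f)
  have hle : ∀ k f, Q (.y k f) → lev (.x k f) ≤ lev (.y k f) := by
    intro k f h
    by_cases hy : P (.y k f)
    · exact M.lev_le k f hy
    · refine (hzero k f fun hx => ?_).ge
      exact ((hess k f).1 ⟨hx, hy⟩).2 (h.resolve_left hy)
  have hle' : ∀ k f, Q (.y k f) → lev' (.x k f) ≤ lev' (.y k f) := by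
    intro k f h
    by_cases hy : P' (.y k f)
    · exact M'.lev_le k f hy
    · refine (hzero' k f fun hx => ?_).ge
      exact ((hess k f).2 ⟨hx, hy⟩).2 (h.resolve_right hy)
  let ι : ∀ k, {g : Gen Ω // Q g ∧ g.deg = k} →
      {g : Gen Ω // P g ∧ g.deg = k} ⊕ {g : Gen Ω // P' g ∧ g.deg = k} := fun k g =>
    if h : P g.1 then Sum.inl ⟨g.1, h, g.2.2⟩ else
      Sum.inr ⟨g.1, g.2.1.resolve_left h, g.2.2⟩
  have hι : ∀ k, Function.Injective (ι k) := by
    rintro k ⟨g, hg⟩ ⟨g', hg'⟩ h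
    by_cases h1 : P g <;> by_cases h2 : P g' <;> simp [ι, h1, h2] at h <;> exact Subtype.ext h
  have hfin : ∀ k, Finite {g : Gen Ω // Q g ∧ g.deg = k} := by
    intro k
    have := M.finite k
    have := M'.finite k
    exact Finite.of_injective _ (hι k)
  choose X _ _ hX using fun k => exists_module_basis (M.basis k) (M'.basis k) (ι k) (hι k)
  let B := fun k => (hX k).some
  -- The ends must be equal to `C` and `D`, not merely isomorphic, so they are inserted by cases.
  -- Only for `s` strictly between them is a new complex built; outside the unit interval the value
  -- is arbitrary.
  have key : ∀ s : ℝ, ∃ F : FloerComplex.{u, v} K Γ, (s = 0 → F = C) ∧ (s = 1 → F = D) ∧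
      (s ∈ Set.Icc (0 : ℝ) 1 → ∃ R : Gen Ω → Prop, Nonempty (BarModel F R (L s)) ∧
        (∀ k f, (P (.x k f) ∧ ¬ P (.y k f)) ↔ (R (.x k f) ∧ ¬ R (.y k f))) ∧
        ∀ k f, ¬ R (.x k f) → L s (.y k f) = L s (.x k f)) := by
    intro s
    by_cases h0 : s = 0
    · subst h0
      have hL : L 0 = lev := by funext g; simp [L]
      refine ⟨C, fun _ => rfl, fun h => absurd h zero_ne_one, fun _ => ⟨P, ?_⟩⟩
      rw [hL]
      exact ⟨⟨M⟩, fun _ _ => Iff.rfl, hzero⟩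
    by_cases h1 : s = 1
    · subst h1
      have hL : L 1 = lev' := by funext g; simp [L]
      refine ⟨D, fun h => absurd h one_ne_zero, fun _ => rfl, fun _ => ⟨P', ?_⟩⟩
      rw [hL]
      exact ⟨⟨M'⟩, hess, hzero'⟩
    by_cases hs : s ∈ Set.Icc (0 : ℝ) 1
    · have hsle : ∀ k f, Q (.y k f) → L s (.x k f) ≤ L s (.y k f) := fun k f h =>
        add_le_add (mul_le_mul_of_nonneg_left (hle k f h) (sub_nonneg.2 hs.2))
          (mul_le_mul_of_nonneg_left (hle' k f h) hs.1)
      refine ⟨ModelComplex.floerComplex hQ X B hsle, fun h => absurd h h0,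
        fun h => absurd h h1, fun _ => ⟨Q, ⟨ModelComplex.barModel hQ X B hsle⟩, ?_, ?_⟩⟩
      · intro k f
        have := hess k f
        simp only [Q]
        tauto
      · intro k f h
        simp only [L]
        rw [hzero k f fun h' => h (Or.inl h'), hzero' k f fun h' => h (Or.inr h')]
    · exact ⟨C, fun h => absurd h h0, fun h => absurd h h1, fun h => absurd h hs⟩
  choose F hF0 hF1 hF using key
  -- No exceptional parameters are needed, since bars appear and disappear only at the two ends,
  -- where they have length zero.
  refine ⟨∅, F, by simp, hF0 0 rfl, hF1 1 rfl, fun s hs t ht => ?_⟩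
  obtain ⟨R, ⟨N⟩, hR, hRz⟩ := hF s hs.1
  obtain ⟨R', ⟨N'⟩, hR', hRz'⟩ := hF t ht.1
  refine N.quasiequivalent N' (fun k f => (hR k f).symm.trans (hR' k f)) (fun g => ?_) hRz hRz'
  have : L s g - L t g = (lev g - lev' g) * (t - s) := by simp only [L]; ring
  rw [this, abs_mul, abs_sub_comm t s]
  exact mul_le_mul_of_nonneg_right (hlev g) (abs_nonneg _)

end Interpolation

/-! ### Tracks of matched and unmatched bars -/

section Tracks

variable {Γ : AddSubgroup ℝ}

/-- Lifts a bijection between multisets of values to one between indices, by removing one index of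
each prescribed value at a time. Equal bars may carry many indices, so the values alone do not
determine a pairing. -/
theorem exists_rel_of_multiset_rel {α β : Type*} {r : α → β → Prop} {S : Multiset α}
    {T : Multiset β} (h : Multiset.Rel r S T) {I J : Type*} (f : I → α) (g : J → β)
    (S' : Multiset α) (T' : Multiset β) : ∀ (A : Finset I) (B : Finset J),
    A.val.map f = S' + S → B.val.map g = T' + T →
      ∃ R : I → J → Prop, (∀ i j, R i j → i ∈ A ∧ j ∈ B ∧ r (f i) (g j)) ∧
        (∀ i j j', R i j → R i j' → j = j') ∧ (∀ i i' j, R i j → R i' j → i = i') ∧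
        (∀ i ∈ A, (∃ j, R i j) ∨ f i ∈ S') ∧ ∀ j ∈ B, (∃ i, R i j) ∨ g j ∈ T' := by
  classical
  induction h with
  | zero =>
    intro A B hA hB
    rw [add_zero] at hA hB
    refine ⟨fun _ _ => False, by simp, by simp, by simp, fun i hi => Or.inr ?_,
      fun j hj => Or.inr ?_⟩
    · rw [← hA]; exact Multiset.mem_map_of_mem f hi
    · rw [← hB]; exact Multiset.mem_map_of_mem g hj
  | @cons a b as bs hab _ ih =>
    intro A B hA hB
    obtain ⟨i, hi, rfl⟩ := Multiset.mem_map.1 (show a ∈ A.val.map f by rw [hA]; simp)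
    obtain ⟨j, hj, rfl⟩ := Multiset.mem_map.1 (show b ∈ B.val.map g by rw [hB]; simp)
    have hA' : (A.erase i).val.map f = S' + as := by
      rw [← Multiset.cons_erase hi, Multiset.map_cons, Multiset.add_cons,
        Multiset.cons_inj_right] at hA
      rwa [Finset.erase_val]
    have hB' : (B.erase j).val.map g = T' + bs := by
      rw [← Multiset.cons_erase hj, Multiset.map_cons, Multiset.add_cons,
        Multiset.cons_inj_right] at hB
      rwa [Finset.erase_val]
    obtain ⟨R, hR, hfun, hinj, hs, ht⟩ := ih _ _ hA' hB'
    have hRi : ∀ j', ¬ R i j' := fun j' h => Finset.notMem_erase i A (hR _ _ h).1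
    have hRj : ∀ i', ¬ R i' j := fun i' h => Finset.notMem_erase j B (hR _ _ h).2.1
    refine ⟨fun i' j' => (i' = i ∧ j' = j) ∨ R i' j', ?_, ?_, ?_, ?_, ?_⟩
    · rintro i' j' (⟨rfl, rfl⟩ | h)
      · exact ⟨hi, hj, hab⟩
      · exact ⟨Finset.mem_of_mem_erase (hR _ _ h).1, Finset.mem_of_mem_erase (hR _ _ h).2.1,
          (hR _ _ h).2.2⟩
    · rintro i' j' j'' (⟨rfl, rfl⟩ | h) (⟨h1, rfl⟩ | h')
      · rfl
      · exact absurd h' (hRi _)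
      · exact absurd (h1 ▸ h) (hRi _)
      · exact hfun _ _ _ h h'
    · rintro i' i'' j' (⟨rfl, rfl⟩ | h) (⟨rfl, h1⟩ | h')
      · rfl
      · exact absurd h' (hRj _)
      · exact absurd (h1 ▸ h) (hRj _)
      · exact hinj _ _ _ h h'
    · intro i' hi'
      by_cases h : i' = i
      · exact Or.inl ⟨j, Or.inl ⟨h, rfl⟩⟩
      · exact (hs i' (Finset.mem_erase.2 ⟨h, hi'⟩)).imp_left fun ⟨j', h'⟩ => ⟨j', Or.inr h'⟩
    · intro j' hj'
      by_cases h : j' = j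
      · exact Or.inl ⟨i, Or.inl ⟨rfl, h⟩⟩
      · exact (ht j' (Finset.mem_erase.2 ⟨h, hj'⟩)).imp_left fun ⟨i', h'⟩ => ⟨i', Or.inr h'⟩

/-- The pairs matched by a relation, and the unmatched elements of both sides. -/
inductive Track {I J : Type} (R : I → J → Prop) : Type
  | both (i : I) (j : J) (h : R i j) : Track R
  | left (i : I) (h : ∀ j, ¬ R i j) : Track R
  | right (j : J) (h : ∀ i, ¬ R i j) : Track R

namespace Track

variable {I J : Type} {R : I → J → Prop}

/-- The element of the left side on a track. -/
def fst : Track R → Option I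
  | .both i _ _ => some i
  | .left i _ => some i
  | .right _ _ => none

/-- The element of the right side on a track. -/
def snd : Track R → Option J
  | .both _ j _ => some j
  | .left _ _ => none
  | .right j _ => some j

theorem existsUnique_fst (hR : ∀ i j j', R i j → R i j' → j = j') (i : I) :
    ∃! f : Track R, f.fst = some i := by
  by_cases h : ∃ j, R i j
  · obtain ⟨j, hj⟩ := h
    refine ⟨.both i j hj, rfl, ?_⟩
    rintro (⟨i', j', h'⟩ | ⟨i', h'⟩ | ⟨j', h'⟩) hf
    · obtain rfl : i' = i := Option.some_injective _ hf
      obtain rfl := hR _ _ _ hj h'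
      rfl
    · obtain rfl : i' = i := Option.some_injective _ hf
      exact absurd hj (h' j)
    · exact absurd hf (by simp [fst])
  · push Not at h
    refine ⟨.left i h, rfl, ?_⟩
    rintro (⟨i', j', h'⟩ | ⟨i', h'⟩ | ⟨j', h'⟩) hf
    · obtain rfl : i' = i := Option.some_injective _ hf
      exact absurd h' (h j')
    · obtain rfl : i' = i := Option.some_injective _ hf
      rfl
    · exact absurd hf (by simp [fst])

theorem existsUnique_snd (hR : ∀ i i' j, R i j → R i' j → i = i') (j : J) :
    ∃! f : Track R, f.snd = some j := by
  by_cases h : ∃ i, R i j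
  · obtain ⟨i, hi⟩ := h
    refine ⟨.both i j hi, rfl, ?_⟩
    rintro (⟨i', j', h'⟩ | ⟨i', h'⟩ | ⟨j', h'⟩) hf
    · obtain rfl : j' = j := Option.some_injective _ hf
      obtain rfl := hR _ _ _ hi h'
      rfl
    · exact absurd hf (by simp [snd])
    · obtain rfl : j' = j := Option.some_injective _ hf
      exact absurd hi (h' i)
  · push Not at h
    refine ⟨.right j h, rfl, ?_⟩
    rintro (⟨i', j', h'⟩ | ⟨i', h'⟩ | ⟨j', h'⟩) hf
    · obtain rfl : j' = j := Option.some_injective _ hf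
      exact absurd h' (h i')
    · exact absurd hf (by simp [snd])
    · obtain rfl : j' = j := Option.some_injective _ hf
      rfl

end Track

/-- Each track has ends on both sides. For an unmatched bar the other side receives the degenerate
interval at its midpoint; a length of at most `2ρ` makes each end move by at most `ρ`. -/
theorem exists_tracks {I I' J J' : Type} {x : I ⊕ I' → ℝ} {y : I → ℝ} {x' : J ⊕ J' → ℝ}
    {y' : J → ℝ} {R : I ⊕ I' → J ⊕ J' → Prop} {ρ : ℝ}
    (hfun : ∀ i j j', R i j → R i j' → j = j') (hinj : ∀ i i' j, R i j → R i' j → i = i')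
    (hll : ∀ i j, R (Sum.inl i) (Sum.inl j) → ∃ g : Γ,
      |x (Sum.inl i) - (x' (Sum.inl j) - g)| ≤ ρ ∧ |y i - (y' j - g)| ≤ ρ)
    (hrr : ∀ i j, R (Sum.inr i) (Sum.inr j) → ∃ g : Γ,
      |x (Sum.inr i) - (x' (Sum.inr j) - g)| ≤ ρ)
    (hlr : ∀ i j, ¬ R (Sum.inl i) (Sum.inr j)) (hrl : ∀ i j, ¬ R (Sum.inr i) (Sum.inl j))
    (hl : ∀ i, (∀ j, ¬ R (Sum.inl i) j) → |y i - x (Sum.inl i)| ≤ 2 * ρ)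
    (hr : ∀ j, (∀ i, ¬ R i (Sum.inl j)) → |y' j - x' (Sum.inl j)| ≤ 2 * ρ)
    (hl' : ∀ i, ∃ j, R (Sum.inr i) j) (hr' : ∀ j, ∃ i, R i (Sum.inr j)) :
    ∃ (Ω : Type) (π : Ω → Option (I ⊕ I')) (π' : Ω → Option (J ⊕ J')) (γ : Ω → Γ)
      (a b a' b' : Ω → ℝ), (∀ i, ∃! f, π f = some i) ∧ (∀ j, ∃! f, π' f = some j) ∧
      (∀ f i, π f = some i → a f = x i) ∧ (∀ f i, π f = some (Sum.inl i) → b f = y i) ∧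
      (∀ f j, π' f = some j → a' f = x' j - γ f) ∧
      (∀ f j, π' f = some (Sum.inl j) → b' f = y' j - γ f) ∧
      (∀ f, (¬ ∃ i, π f = some i) → b f = a f) ∧ (∀ f, (¬ ∃ j, π' f = some j) → b' f = a' f) ∧
      (∀ f, |a f - a' f| ≤ ρ) ∧ (∀ f, |b f - b' f| ≤ ρ) ∧
      ∀ f, (∃ i, π f = some (Sum.inr i)) ↔ ∃ j, π' f = some (Sum.inr j) := by
  -- Infinite bars get their left end as a dummy right end, which satisfies the same estimates and
  -- carries no generator.
  let Y : I ⊕ I' → ℝ := Sum.elim y fun i => x (Sum.inr i)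
  let Y' : J ⊕ J' → ℝ := Sum.elim y' fun j => x' (Sum.inr j)
  have hboth : ∀ i j, R i j → ∃ g : Γ, |x i - (x' j - g)| ≤ ρ ∧ |Y i - (Y' j - g)| ≤ ρ := by
    rintro (i | i) (j | j) h
    · exact hll i j h
    · exact absurd h (hlr i j)
    · exact absurd h (hrl i j)
    · obtain ⟨g, hg⟩ := hrr i j h
      exact ⟨g, hg, hg⟩
  have hleft : ∀ i, (∀ j, ¬ R i j) → |Y i - x i| ≤ 2 * ρ := by
    rintro (i | i) h
    · exact hl i h
    · obtain ⟨j, hj⟩ := hl' i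
      exact absurd hj (h j)
  have hright : ∀ j, (∀ i, ¬ R i j) → |Y' j - x' j| ≤ 2 * ρ := by
    rintro (j | j) h
    · exact hr j h
    · obtain ⟨i, hi⟩ := hr' j
      exact absurd hi (h i)
  choose G hGx hGy using hboth
  refine ⟨Track R, Track.fst, Track.snd,
    fun | .both i j h => G i j h | .left _ _ => 0 | .right _ _ => 0,
    fun | .both i _ _ => x i | .left i _ => x i | .right j _ => (x' j + Y' j) / 2,
    fun | .both i _ _ => Y i | .left i _ => Y i | .right j _ => (x' j + Y' j) / 2,
    fun | .both i j h => x' j - G i j h | .left i _ => (x i + Y i) / 2 | .right j _ => x' j,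
    fun | .both i j h => Y' j - G i j h | .left i _ => (x i + Y i) / 2 | .right j _ => Y' j,
    Track.existsUnique_fst hfun, Track.existsUnique_snd hinj, ?_, ?_, ?_, ?_, ?_, ?_, ?_, ?_, ?_⟩
  · rintro (⟨i, j, h⟩ | ⟨i, h⟩ | ⟨j, h⟩) i' hf
    · obtain rfl := Option.some_injective _ hf
      rfl
    · obtain rfl := Option.some_injective _ hf
      rfl
    · exact absurd hf (by simp [Track.fst])
  · rintro (⟨i, j, h⟩ | ⟨i, h⟩ | ⟨j, h⟩) i' hf
    · obtain rfl := Option.some_injective _ hf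
      rfl
    · obtain rfl := Option.some_injective _ hf
      rfl
    · exact absurd hf (by simp [Track.fst])
  · rintro (⟨i, j, h⟩ | ⟨i, h⟩ | ⟨j, h⟩) j' hf
    · obtain rfl := Option.some_injective _ hf
      rfl
    · exact absurd hf (by simp [Track.snd])
    · obtain rfl := Option.some_injective _ hf
      simp
  · rintro (⟨i, j, h⟩ | ⟨i, h⟩ | ⟨j, h⟩) j' hf
    · obtain rfl := Option.some_injective _ hf
      rfl
    · exact absurd hf (by simp [Track.snd])
    · obtain rfl := Option.some_injective _ hf
      simp [Y']
  · rintro (⟨i, j, h⟩ | ⟨i, h⟩ | ⟨j, h⟩) hf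
    · exact absurd ⟨i, rfl⟩ hf
    · exact absurd ⟨i, rfl⟩ hf
    · rfl
  · rintro (⟨i, j, h⟩ | ⟨i, h⟩ | ⟨j, h⟩) hf
    · exact absurd ⟨j, rfl⟩ hf
    · rfl
    · exact absurd ⟨j, rfl⟩ hf
  · rintro (⟨i, j, h⟩ | ⟨i, h⟩ | ⟨j, h⟩)
    · exact hGx i j h
    · have := abs_le.1 (hleft i h)
      exact abs_le.2 ⟨by linarith, by linarith⟩
    · have := abs_le.1 (hright j h)
      exact abs_le.2 ⟨by linarith, by linarith⟩
  · rintro (⟨i, j, h⟩ | ⟨i, h⟩ | ⟨j, h⟩)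
    · exact hGy i j h
    · have := abs_le.1 (hleft i h)
      exact abs_le.2 ⟨by linarith, by linarith⟩
    · have := abs_le.1 (hright j h)
      exact abs_le.2 ⟨by linarith, by linarith⟩
  · rintro (⟨i | i, j | j, h⟩ | ⟨i | i, h⟩ | ⟨j | j, h⟩)
    · simp [Track.fst, Track.snd]
    · exact absurd h (hlr i j)
    · exact absurd h (hrl i j)
    · simp [Track.fst, Track.snd]
    · simp [Track.fst, Track.snd]
    · obtain ⟨j, hj⟩ := hl' i
      exact absurd hj (h j)
    · simp [Track.fst, Track.snd]
    · obtain ⟨i, hi⟩ := hr' j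
      exact absurd hi (h i)

end Tracks

/-! ### From matchings to interpolations: `d_P ≤ d_B` -/

section MatchingInterpolation

variable {K : Type u} [Field K] {Γ : AddSubgroup ℝ} {C D : FloerComplex.{u, v} K Γ}

/-- The bar belonging to an element of the basis of the cycles in a singular value decomposition. -/
noncomputable def barOf {k : ℤ} (s : C.BoundarySVD k) : Fin s.r ⊕ Fin s.q → Bar Γ :=
  Sum.elim (fun i => ((FloerComplex.levelX s (Sum.inl i) : ℝ ⧸ Γ),
      ENNReal.ofReal (FloerComplex.levelY s i - FloerComplex.levelX s (Sum.inl i))))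
    fun j => ((FloerComplex.levelX s (Sum.inr j) : ℝ ⧸ Γ), ⊤)

theorem verboseBarcode_eq_map {k : ℤ} (s : C.BoundarySVD k) :
    verboseBarcode s = (Finset.univ : Finset (Fin s.r ⊕ Fin s.q)).val.map (barOf s) := by
  rw [verboseBarcode_eq, ← Finset.univ_disjSum_univ, Finset.val_disjSum, Multiset.disjSum,
    Multiset.map_add, Multiset.map_map, Multiset.map_map]
  rfl

/-- Bases see the verbose barcode while matchings see the concise one. The difference consists of
bars of length zero, which may always be left unmatched. -/
theorem verboseBarcode_eq_add {k : ℤ} (s : C.BoundarySVD k) :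
    ∃ S : Multiset (Bar Γ), verboseBarcode s = S + conciseBarcode s ∧ ∀ b ∈ S, b.2 = 0 := by
  classical
  refine ⟨(verboseBarcode s).filter fun b => ¬ 0 < b.2, ?_, fun b hb => ?_⟩
  · rw [conciseBarcode, add_comm]
    convert (Multiset.filter_add_not (fun b : Bar Γ => 0 < b.2) (verboseBarcode s)).symm
  · have := (Multiset.mem_filter.1 hb).2
    simpa using this

theorem length_barOf_inl_le {k : ℤ} (s : C.BoundarySVD k) (i : Fin s.r) {δ : ℝ≥0}
    (h : (barOf s (Sum.inl i)).2 ≤ 2 * (δ : ℝ≥0∞)) :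
    |FloerComplex.levelY s i - FloerComplex.levelX s (Sum.inl i)| ≤ 2 * (δ : ℝ) := by
  have h1 : (2 * (δ : ℝ≥0∞)) = ENNReal.ofReal (2 * (δ : ℝ)) := by
    rw [ENNReal.ofReal_mul (by norm_num), ENNReal.ofReal_coe_nnreal]
    simp
  rw [h1] at h
  have h2 := (ENNReal.ofReal_le_ofReal_iff (by positivity)).1 h
  have h3 := FloerComplex.levelX_le_levelY s i
  rw [abs_of_nonneg (by linarith)]
  exact h2

/-- A matching of concise barcodes as a relation between the elements of bases of the cycles. -/
theorem HasMatching.exists_rel {δ : ℝ≥0} {k : ℤ} {s : C.BoundarySVD k} {t : D.BoundarySVD k}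
    (h : HasMatching δ (conciseBarcode s) (conciseBarcode t)) :
    ∃ R : Fin s.r ⊕ Fin s.q → Fin t.r ⊕ Fin t.q → Prop,
      (∀ i j, R i j → BarClose δ (barOf s i) (barOf t j)) ∧
      (∀ i j j', R i j → R i j' → j = j') ∧ (∀ i i' j, R i j → R i' j → i = i') ∧
      (∀ i, (∀ j, ¬ R i j) → (barOf s i).2 ≤ 2 * (δ : ℝ≥0∞)) ∧
      ∀ j, (∀ i, ¬ R i j) → (barOf t j).2 ≤ 2 * (δ : ℝ≥0∞) := by
  obtain ⟨S, S', T, T', hS, hT, hSs, hTs, hrel⟩ := h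
  obtain ⟨Z, hZ, hZ0⟩ := verboseBarcode_eq_add s
  obtain ⟨W, hW, hW0⟩ := verboseBarcode_eq_add t
  rw [hS, ← add_assoc, verboseBarcode_eq_map] at hZ
  rw [hT, ← add_assoc, verboseBarcode_eq_map] at hW
  obtain ⟨R, hR, hfun, hinj, hs, ht⟩ := exists_rel_of_multiset_rel hrel _ _ _ _ _ _ hZ hW
  refine ⟨R, fun i j h => (hR i j h).2.2, hfun, hinj, fun i hi => ?_, fun j hj => ?_⟩
  · rcases hs i (Finset.mem_univ i) with ⟨j, hj⟩ | h
    · exact absurd hj (hi j)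
    · rcases Multiset.mem_add.1 h with h | h
      · rw [hZ0 _ h]; exact zero_le
      · exact hSs _ h
  · rcases ht j (Finset.mem_univ j) with ⟨i, hi⟩ | h
    · exact absurd hi (hj i)
    · rcases Multiset.mem_add.1 h with h | h
      · rw [hW0 _ h]; exact zero_le
      · exact hTs _ h

/-- Closeness provides representatives only within `δ + ε`, and these may depend on `ε`. Taking `ε =
ρ - δ` fixes a single element of `Γ`, which explains the strict inequality. -/
theorem BarClose.exists_shift {δ ρ : ℝ≥0} (hδ : δ < ρ) {a a' : ℝ} {L L' : ℝ≥0∞}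
    (h : BarClose δ ((a : ℝ ⧸ Γ), L) ((a' : ℝ ⧸ Γ), L')) :
    ∃ g : Γ, |a - (a' - g)| ≤ ρ ∧ ((L = ⊤ ∧ L' = ⊤) ∨
      (L ≠ ⊤ ∧ L' ≠ ⊤ ∧ |(a + L.toReal) - (a' + L'.toReal - g)| ≤ ρ)) := by
  have hδ' : (δ : ℝ) < ρ := hδ
  obtain ⟨c, hc, h1, h2⟩ := h a rfl (ρ - δ) (sub_pos.2 hδ')
  rw [add_sub_cancel] at h1 h2
  obtain ⟨g, hg⟩ : ∃ g : Γ, (g : ℝ) = -c + a' := ⟨⟨_, QuotientAddGroup.eq.1 hc⟩, rfl⟩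
  refine ⟨g, ?_, h2.imp id fun ⟨h3, h4, h5⟩ => ⟨h3, h4, ?_⟩⟩
  · rw [hg, abs_sub_comm]
    convert h1 using 2
    ring
  · rw [hg, abs_sub_comm]
    convert h5 using 2
    ring

theorem HasMatching.exists_tracks {δ ρ : ℝ≥0} (hδ : δ < ρ) {k : ℤ} {s : C.BoundarySVD k}
    {t : D.BoundarySVD k} (h : HasMatching δ (conciseBarcode s) (conciseBarcode t)) :
    ∃ (Ω : Type) (π : Ω → Option (Fin s.r ⊕ Fin s.q)) (π' : Ω → Option (Fin t.r ⊕ Fin t.q))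
      (γ : Ω → Γ) (a b a' b' : Ω → ℝ), (∀ i, ∃! f, π f = some i) ∧ (∀ j, ∃! f, π' f = some j) ∧
      (∀ f i, π f = some i → a f = FloerComplex.levelX s i) ∧
      (∀ f i, π f = some (Sum.inl i) → b f = FloerComplex.levelY s i) ∧
      (∀ f j, π' f = some j → a' f = FloerComplex.levelX t j - γ f) ∧
      (∀ f j, π' f = some (Sum.inl j) → b' f = FloerComplex.levelY t j - γ f) ∧
      (∀ f, (¬ ∃ i, π f = some i) → b f = a f) ∧ (∀ f, (¬ ∃ j, π' f = some j) → b' f = a' f) ∧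
      (∀ f, |a f - a' f| ≤ ρ) ∧ (∀ f, |b f - b' f| ≤ ρ) ∧
      ∀ f, (∃ i, π f = some (Sum.inr i)) ↔ ∃ j, π' f = some (Sum.inr j) := by
  have hδ' : (δ : ℝ) < ρ := hδ
  obtain ⟨R, hR, hfun, hinj, hs, ht⟩ := h.exists_rel
  have hinf : ¬ (⊤ : ℝ≥0∞) ≤ 2 * (δ : ℝ≥0∞) :=
    (ENNReal.mul_lt_top (by simp) ENNReal.coe_lt_top).not_ge
  refine Floer.exists_tracks hfun hinj (fun i j hij => ?_) (fun i j hij => ?_)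
    (fun i j hij => ?_) (fun i j hij => ?_)
    (fun i hi => (length_barOf_inl_le s i (hs _ hi)).trans (by linarith))
    (fun j hj => (length_barOf_inl_le t j (ht _ hj)).trans (by linarith))
    (fun i => ?_) (fun j => ?_)
  · obtain ⟨g, h1, h2⟩ := BarClose.exists_shift hδ (hR _ _ hij)
    refine ⟨g, h1, ?_⟩
    obtain ⟨-, -, h3⟩ := h2.resolve_left fun h => ENNReal.ofReal_ne_top h.1
    rw [ENNReal.toReal_ofReal (sub_nonneg.2 (FloerComplex.levelX_le_levelY s i)),
      ENNReal.toReal_ofReal (sub_nonneg.2 (FloerComplex.levelX_le_levelY t j)), add_sub_cancel,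
      add_sub_cancel] at h3
    exact h3
  · obtain ⟨g, h1, -⟩ := BarClose.exists_shift hδ (hR _ _ hij)
    exact ⟨g, h1⟩
  · obtain ⟨g, -, h | h⟩ := BarClose.exists_shift hδ (hR _ _ hij)
    · exact ENNReal.ofReal_ne_top h.1
    · exact h.2.1 rfl
  · obtain ⟨g, -, h | h⟩ := BarClose.exists_shift hδ (hR _ _ hij)
    · exact ENNReal.ofReal_ne_top h.2
    · exact h.1 rfl
  · by_contra! hi
    exact hinf (hs _ hi)
  · by_contra! hj
    exact hinf (ht _ hj)

theorem hasInterpolation_of_hasMatching {δ ρ : ℝ≥0} (hδ : δ < ρ) (s : ∀ k : ℤ, C.BoundarySVD k)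
    (t : ∀ k : ℤ, D.BoundarySVD k)
    (h : ∀ k, HasMatching δ (conciseBarcode (s k)) (conciseBarcode (t k))) :
    HasInterpolation ρ C D := by
  choose Ω π π' γ a b a' b' hπ hπ' ha hb ha' hb' hz hz' haa hbb hess using
    fun k => (h k).exists_tracks hδ
  let lev : Gen Ω → ℝ := fun | .x k f => a k f | .y k f => b k f
  let lev' : Gen Ω → ℝ := fun | .x k f => a' k f | .y k f => b' k f
  -- The bases of `C` are not rescaled; all shifts by `Γ` are carried out on the side of `D`.
  obtain ⟨M⟩ := FloerComplex.nonempty_barModel s π hπ (fun _ _ => 0) (lev := lev)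
    (fun k f i hf => by simpa using ha k f i hf) (fun k f i hf => by simpa using hb k f i hf)
  obtain ⟨M'⟩ := FloerComplex.nonempty_barModel t π' hπ' γ (lev := lev') ha' hb'
  refine M.hasInterpolation M' (fun k f => ?_) ?_ hz hz'
  · have hinf : ∀ {α β : Type} (o : Option (α ⊕ β)),
        ((∃ i, o = some i) ∧ ¬ ∃ i, o = some (Sum.inl i)) ↔ ∃ i, o = some (Sum.inr i) := by
      rintro α β (_ | (i | i)) <;> simp
    exact (hinf _).trans ((hess k f).trans (hinf _).symm)
  · rintro (⟨k, f⟩ | ⟨k, f⟩)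
    · exact haa k f
    · exact hbb k f

theorem HasMatching.mono {δ ρ : ℝ≥0} (hδ : δ ≤ ρ) {S T : Multiset (Bar Γ)}
    (h : HasMatching δ S T) : HasMatching ρ S T := by
  obtain ⟨a, b, c, d, h1, h2, h3, h4, h5⟩ := h
  have hδ' : (δ : ℝ) ≤ ρ := hδ
  have hle : 2 * (δ : ℝ≥0∞) ≤ 2 * (ρ : ℝ≥0∞) := by gcongr
  refine ⟨a, b, c, d, h1, h2, fun x hx => (h3 x hx).trans hle, fun x hx => (h4 x hx).trans hle,
    h5.mono fun x _ y _ hxy e he ε hε => ?_⟩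
  obtain ⟨e', he', h6, h7⟩ := hxy e he ε hε
  exact ⟨e', he', by linarith, h7.imp id fun ⟨h8, h9, h10⟩ => ⟨h8, h9, by linarith⟩⟩

theorem interpolatingDist_le_gradedBottleneckDist (s : ∀ k : ℤ, C.BoundarySVD k)
    (t : ∀ k : ℤ, D.BoundarySVD k) : interpolatingDist C D ≤
      gradedBottleneckDist (fun k => conciseBarcode (s k)) (fun k => conciseBarcode (t k)) := by
  refine ENNReal.le_of_forall_pos_le_add fun ε hε hfin => ?_
  set d := gradedBottleneckDist (fun k => conciseBarcode (s k)) fun k => conciseBarcode (t k)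
  obtain ⟨d', hd'⟩ : ∃ d' : ℝ≥0, (d' : ℝ≥0∞) = d := ⟨d.toNNReal, ENNReal.coe_toNNReal hfin.ne⟩
  -- One half of `ε` reaches past the infimum, simultaneously in all degrees; the other half
  -- supplies the strict inequality needed to choose shifts.
  have hε2 : 0 < ε / 2 := half_pos hε
  have hmatch : ∀ k, HasMatching (d' + ε / 2) (conciseBarcode (s k)) (conciseBarcode (t k)) := by
    intro k
    have hlt : bottleneckDist (conciseBarcode (s k)) (conciseBarcode (t k)) <
        ((d' + ε / 2 : ℝ≥0) : ℝ≥0∞) := by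
      refine lt_of_le_of_lt (le_iSup (fun k => bottleneckDist (conciseBarcode (s k))
        (conciseBarcode (t k))) k) ?_
      change d < _
      rw [← hd']
      exact_mod_cast lt_add_of_pos_right d' hε2
    simp only [bottleneckDist, iInf_lt_iff] at hlt
    obtain ⟨δ, hδ, hlt⟩ := hlt
    exact hδ.mono (by exact_mod_cast hlt.le)
  have hlt : d' + ε / 2 < d' + ε := by
    have := half_lt_self hε
    gcongr
  rw [← hd']
  exact iInf₂_le (d' + ε) (hasInterpolation_of_hasMatching hlt s t hmatch)

end MatchingInterpolation

end Floer

theorem theorem10p2 {K : Type u} [Field K] {Γ : AddSubgroup ℝ}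
    (C D : Floer.FloerComplex.{u, v} K Γ) :
    (∀ k : ℤ, Nonempty (C.BoundarySVD k)) ∧ (∀ k : ℤ, Nonempty (D.BoundarySVD k)) ∧
    ∀ (sC : ∀ k : ℤ, C.BoundarySVD k) (sD : ∀ k : ℤ, D.BoundarySVD k),
      Floer.gradedBottleneckDist (fun k => Floer.conciseBarcode (sC k))
          (fun k => Floer.conciseBarcode (sD k)) =
        Floer.interpolatingDist C D :=
  ⟨C.nonempty_boundarySVD, D.nonempty_boundarySVD, fun sC sD =>
    le_antisymm (Floer.gradedBottleneckDist_le_interpolatingDist sC sD)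
      (Floer.interpolatingDist_le_gradedBottleneckDist sC sD)⟩
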